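/- Let $\|\cdot\|_F$ be the Frobenius norm. For a real matrix $A\ne 0$ let $\kappa=\kappa(A)$ be its condition number, i.e. its largest singular value divided by its smallest nonzero singular value. For a real matrix $M\neq 0$ let $|M\rangle=\|M\|_F^{-1}\sum_{i,j}M_{ij}|i\rangle|j\rangle$, where indices are written in binary on the least sufficient number of qubits. Quantum access to $A\in\mathbb R^{l\times m}$ and $B\in\mathbb R^{m\times n}$ means that the following unitaries and their inverses may be used as gates: $|i\rangle|0\rangle\mapsto|i\rangle|A_i\rangle$, where $|A_i\rangle$ is the normalized $i$-th row of $A$ (any unit vector if that row is zero or $i$ is not the label of a row); $|0\rangle|j\rangle\mapsto \|A\|_F^{-1}\sum_i\|A_i\|_2\,|i\rangle|j\rangle$, where $A_i$ is the $i$-th row of $A$; $|0\rangle|0\rangle\mapsto|B\rangle$. Each such use takes time $(1+\log(lmn))^a$ for some fixed $a\in\mathbb N$ (state preparation in polylogarithmic time). Elementary gates (NOT, Hadamard, $T$, CNOT, Toffoli) and one-qubit measurements take time $1$. Theorem. There is a quantum algorithm, determined by $l,m,n,\varepsilon,\delta$ only (it is not given $\kappa$ or any of the norms $\|A\|_F,\|B\|_F,\|AB\|_F$,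 and it uses $A$ and $B$ only through the above access), that performs a sequence of rounds, each one a circuit on qubits initialized in $|0\rangle$ followed by the measurement of a flag qubit, until a round succeeds (the outcome is $1$), such that the following holds. For every $a\in\mathbb N$ there are $C>0$ and $k\in\mathbb N$ such that for all $l,m,n$, all real $A\in\mathbb R^{l\times m}$, $B\in\mathbb R^{m\times n}$ with $AB\ne0$, all $0<\varepsilon\le1$ and $0<\delta<1$, and all access unitaries for $A$ and $B$: (i) whenever a round succeeds, the state after the measurement is, up to a global phase, within Euclidean distance $\varepsilon$ of $|AB\rangle$ (with the flag equal to $1$ and all other qubits in $|0\rangle$); (ii) with probability at least $1-\delta$ the algorithm succeeds within time $$C\,\frac{\|A\|_F\|B\|_F\,\kappa^2}{\varepsilon\,\|AB\|_F}\,\bigl(1+\log(lmn)\bigr)^k\,\bigl(1+\log(1/\delta)\bigr).$$ In other words, the quantum state of $AB$ can be obtained to precision $\varepsilon$ in time $\widetilde O\bigl(\|A\|_F\|B\|_F\,\kappa^2/(\varepsilon\|AB\|_F)\bigr)$. -/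

import Mathlib

open scoped Matrix.Norms.Frobenius

noncomputable section

namespace QMatMul

/-! ### States of finite families of qubits -/

/-- Computational basis labels of the qubits in `W`. -/
abbrev Bits (W : Type) : Type := W → Bool

/-- The all-zero basis label. -/
def zeros (W : Type) : Bits W := fun _ => false

/-- A vector of amplitudes on the qubits in `W`. -/
abbrev State (W : Type) : Type := Bits W → ℂ

/-- The computational basis state `|0…0⟩`. -/
def ketZero (W : Type) [Fintype W] : State W :=
  fun x => if x = zeros W then 1 else 0

/-- The Euclidean (`ℓ²`) norm of an amplitude vector. -/
def stateNorm {W : Type} [Fintype W] [DecidableEq W] (ψ : State W) : ℝ :=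
  ‖(WithLp.toLp 2 ψ : EuclideanSpace ℂ (Bits W))‖

/-- Binary encoding of an index `i < n` by `b` qubits (faithful when `n ≤ 2 ^ b`). -/
def enc {n : ℕ} (b : ℕ) (i : Fin n) : Bits (Fin b) := fun t => (i : ℕ).testBit t

/-- The unnormalized amplitude vector `∑ j, v j |j⟩` on `b` qubits. -/
def ketVec {n : ℕ} (b : ℕ) (v : Fin n → ℝ) : State (Fin b) :=
  fun y => ∑ j, if enc b j = y then (v j : ℂ) else 0

/-- The amplitude, at the basis label `(x, y)`, of the unnormalized vector
`∑ i j, M i j |i⟩|j⟩`. -/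
def ketMat {m n : ℕ} (b c : ℕ) (M : Matrix (Fin m) (Fin n) ℝ)
    (x : Bits (Fin b)) (y : Bits (Fin c)) : ℂ :=
  ∑ i, ∑ j, if enc b i = x ∧ enc c j = y then (M i j : ℂ) else 0

/-! ### Matrices as quantum data -/

/-- The Euclidean norm of the `i`-th row. -/
def rowNorm {m n : ℕ} (M : Matrix (Fin m) (Fin n) ℝ) (i : Fin m) : ℝ :=
  ‖(WithLp.toLp 2 (M i) : EuclideanSpace ℝ (Fin n))‖

/-- The condition number: the largest singular value divided by the smallest nonzero one
(singular values are listed in decreasing order, the first `M.rank` of them are the nonzero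
ones). -/
def condNumber {m n : ℕ} (M : Matrix (Fin m) (Fin n) ℝ) : ℝ :=
  (Matrix.toEuclideanLin M).singularValues 0 /
    (Matrix.toEuclideanLin M).singularValues (M.rank - 1)

/-- The unitaries by which an algorithm accesses `A` (whose row and column indices have `p` and
`q` bits) and `B` (whose row and column indices have `q` and `r` bits). -/
structure Access (p q r : ℕ) where
  rowPrep : Matrix.unitaryGroup (Bits (Fin p ⊕ Fin q)) ℂ
  normPrep : Matrix.unitaryGroup (Bits (Fin p ⊕ Fin q)) ℂ
  matPrep : Matrix.unitaryGroup (Bits (Fin q ⊕ Fin r)) ℂ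

/-- `U : |i⟩|0⟩ ↦ |i⟩|Aᵢ⟩`, with `|Aᵢ⟩` the normalization of the `i`-th row of `A`. When the row
is zero, or when the label is not the code of a row, `|Aᵢ⟩` may be any unit vector. -/
def PreparesRows {l m : ℕ} (p q : ℕ) (A : Matrix (Fin l) (Fin m) ℝ)
    (U : Matrix (Bits (Fin p ⊕ Fin q)) (Bits (Fin p ⊕ Fin q)) ℂ) : Prop :=
  ∀ x : Bits (Fin p), ∃ φ : State (Fin q),
    (∀ x' y, U (Sum.elim x' y) (Sum.elim x (zeros _)) = if x' = x then φ y else 0) ∧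
    ∀ i : Fin l, enc p i = x → ∀ y, (rowNorm A i : ℂ) * φ y = ketVec q (A i) y

/-- `U : |0⟩|j⟩ ↦ |A_F⟩|j⟩`, where `|A_F⟩ = ‖A‖_F⁻¹ ∑ i, ‖Aᵢ‖ |i⟩`. -/
def PreparesNorms {l m : ℕ} (p q : ℕ) (A : Matrix (Fin l) (Fin m) ℝ)
    (U : Matrix (Bits (Fin p ⊕ Fin q)) (Bits (Fin p ⊕ Fin q)) ℂ) : Prop :=
  ∀ (y : Bits (Fin q)) (x' : Bits (Fin p)) (y' : Bits (Fin q)),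
    U (Sum.elim x' y') (Sum.elim (zeros _) y) =
      if y' = y then ketVec p (rowNorm A) x' / (‖A‖ : ℂ) else 0

/-- `U : |0⟩|0⟩ ↦ |B⟩ = ‖B‖_F⁻¹ ∑ j k, B j k |j⟩|k⟩`. -/
def PreparesMatrix {m n : ℕ} (q r : ℕ) (B : Matrix (Fin m) (Fin n) ℝ)
    (U : Matrix (Bits (Fin q ⊕ Fin r)) (Bits (Fin q ⊕ Fin r)) ℂ) : Prop :=
  ∀ (x : Bits (Fin q)) (y : Bits (Fin r)),
    U (Sum.elim x y) (Sum.elim (zeros _) (zeros _)) = ketMat q r B x y / (‖B‖ : ℂ)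

/-- The access unitaries hold the quantum data of `A` and `B`. -/
structure Access.Encodes {p q r l m n : ℕ} (O : Access p q r)
    (A : Matrix (Fin l) (Fin m) ℝ) (B : Matrix (Fin m) (Fin n) ℝ) : Prop where
  rows : PreparesRows p q A O.rowPrep
  norms : PreparesNorms p q A O.normPrep
  matrix : PreparesMatrix q r B O.matPrep

/-! ### Quantum circuits with access gates -/

/-- Apply the operator `U` to the qubits `e i`, `i : ι`, and the identity to all others. -/
def applyOn {ι W : Type} [Fintype ι] [DecidableEq ι] (e : ι ↪ W)
    (U : Matrix (Bits ι) (Bits ι) ℂ) (ψ : State W) : State W :=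
  fun x => ∑ y : Bits ι, U (x ∘ e) y * ψ (Function.extend e y x)

/-- The NOT gate. -/
def matX : Matrix (Bits (Fin 1)) (Bits (Fin 1)) ℂ :=
  fun x y => if x 0 = !(y 0) then 1 else 0

/-- The Hadamard gate. -/
def matH : Matrix (Bits (Fin 1)) (Bits (Fin 1)) ℂ :=
  fun x y => (if x 0 && y 0 then -1 else 1) / (√2 : ℝ)

/-- The `T` gate `diag(1, exp(iπ/4))`. -/
def matT : Matrix (Bits (Fin 1)) (Bits (Fin 1)) ℂ :=
  Matrix.diagonal fun x => if x 0 then Complex.exp (Complex.I * Real.pi / 4) else 1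

/-- The controlled NOT gate; qubit `0` is the control. -/
def matCNOT : Matrix (Bits (Fin 2)) (Bits (Fin 2)) ℂ :=
  fun x y => if x 0 = y 0 ∧ x 1 = (y 1 ^^ y 0) then 1 else 0

/-- The Toffoli gate; qubits `0` and `1` are the controls. -/
def matToffoli : Matrix (Bits (Fin 3)) (Bits (Fin 3)) ℂ :=
  fun x y => if x 0 = y 0 ∧ x 1 = y 1 ∧ x 2 = (y 2 ^^ (y 0 && y 1)) then 1 else 0

/-- Gates on the qubits in `W`: elementary gates, and the access unitaries and their inverses,
on any choice of distinct qubits. -/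
inductive Gate (p q r : ℕ) (W : Type) : Type
  | X (e : Fin 1 ↪ W)
  | H (e : Fin 1 ↪ W)
  | T (e : Fin 1 ↪ W)
  | CNOT (e : Fin 2 ↪ W)
  | Toffoli (e : Fin 3 ↪ W)
  | rowPrep (e : Fin p ⊕ Fin q ↪ W)
  | rowPrepInv (e : Fin p ⊕ Fin q ↪ W)
  | normPrep (e : Fin p ⊕ Fin q ↪ W)
  | normPrepInv (e : Fin p ⊕ Fin q ↪ W)
  | matPrep (e : Fin q ⊕ Fin r ↪ W)
  | matPrepInv (e : Fin q ⊕ Fin r ↪ W)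

/-- The action of a gate on a state. -/
def Gate.act {p q r : ℕ} {W : Type} (O : Access p q r) : Gate p q r W → State W → State W
  | .X e => applyOn e matX
  | .H e => applyOn e matH
  | .T e => applyOn e matT
  | .CNOT e => applyOn e matCNOT
  | .Toffoli e => applyOn e matToffoli
  | .rowPrep e => applyOn e (O.rowPrep : Matrix _ _ ℂ)
  | .rowPrepInv e => applyOn e (star (O.rowPrep : Matrix _ _ ℂ))
  | .normPrep e => applyOn e (O.normPrep : Matrix _ _ ℂ)
  | .normPrepInv e => applyOn e (star (O.normPrep : Matrix _ _ ℂ))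
  | .matPrep e => applyOn e (O.matPrep : Matrix _ _ ℂ)
  | .matPrepInv e => applyOn e (star (O.matPrep : Matrix _ _ ℂ))

/-- The time of a gate: `1` for an elementary gate, `τ` for a state preparation. -/
def Gate.time {p q r : ℕ} {W : Type} (τ : ℝ) : Gate p q r W → ℝ
  | .X _ => 1
  | .H _ => 1
  | .T _ => 1
  | .CNOT _ => 1
  | .Toffoli _ => 1
  | .rowPrep _ => τ
  | .rowPrepInv _ => τ
  | .normPrep _ => τ
  | .normPrepInv _ => τ
  | .matPrep _ => τ
  | .matPrepInv _ => τ

/-- The qubits of a circuit, in this order: the two registers `p`, `r` of the output `|i⟩|k⟩`, a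
register of `q` qubits, the flag qubit and `s` further ancilla qubits. -/
abbrev Wires (p q r s : ℕ) : Type := Fin p ⊕ Fin r ⊕ Fin q ⊕ Unit ⊕ Fin s

/-- The flag qubit. -/
def flag {p q r s : ℕ} : Wires p q r s := Sum.inr (Sum.inr (Sum.inr (Sum.inl ())))

/-- One round of an algorithm: a circuit (a list of gates, the first one acting first), run on
qubits that are all initialized in `|0⟩`, after which the flag is measured. The round succeeds
when the outcome is `1`. -/
structure Round (p q r : ℕ) where
  ancillas : ℕ
  circuit : List (Gate p q r (Wires p q r ancillas))

namespace Round

variable {p q r : ℕ}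

/-- The state before the measurement. -/
def finalState (R : Round p q r) (O : Access p q r) : State (Wires p q r R.ancillas) :=
  R.circuit.foldl (fun ψ g => g.act O ψ) (ketZero _)

/-- The component of the final state with flag `1`, not normalized. -/
def successPart (R : Round p q r) (O : Access p q r) : State (Wires p q r R.ancillas) :=
  fun x => if x flag then R.finalState O x else 0

/-- The probability that the round succeeds. -/
def successProb (R : Round p q r) (O : Access p q r) : ℝ :=
  stateNorm (R.successPart O) ^ 2

/-- The state after a successful measurement (relevant when the probability of success is
nonzero). -/
def outputState (R : Round p q r) (O : Access p q r) : State (Wires p q r R.ancillas) :=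
  ((stateNorm (R.successPart O) : ℂ))⁻¹ • R.successPart O

/-- The time of a round: its gates and its measurement. -/
def time (R : Round p q r) (τ : ℝ) : ℝ :=
  (R.circuit.map (Gate.time τ)).sum + 1

end Round

/-- The quantum state `|M⟩ = ‖M‖_F⁻¹ ∑ i k, M i k |i⟩|k⟩` in the output registers, with flag `1`
and all other qubits in `|0⟩`. -/
def targetState {l n : ℕ} (p q r s : ℕ) (M : Matrix (Fin l) (Fin n) ℝ) :
    State (Wires p q r s) :=
  fun x =>
    if (∀ t, x (Sum.inr (Sum.inr (Sum.inl t))) = false) ∧ x flag = true ∧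
        ∀ t, x (Sum.inr (Sum.inr (Sum.inr (Sum.inr t)))) = false
    then ketMat p r M (fun t => x (Sum.inl t)) (fun t => x (Sum.inr (Sum.inl t))) / (‖M‖ : ℂ)
    else 0

/-- The state `ψ` equals `χ` to precision `ε`, up to a global phase. -/
def IsClose {W : Type} [Fintype W] [DecidableEq W] (ε : ℝ) (ψ χ : State W) : Prop :=
  ∃ c : ℂ, ‖c‖ = 1 ∧ stateNorm (ψ - c • χ) ≤ ε

/-- An algorithm for the product of an `l × m` and an `m × n` matrix: it performs the rounds
`0, 1, 2, …` one after the other, until the first one that succeeds, and returns the state after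
the measurement of that round. -/
abbrev Algorithm (l m n : ℕ) : Type :=
  ℕ → Round (Nat.clog 2 l) (Nat.clog 2 m) (Nat.clog 2 n)

namespace Algorithm

variable {l m n : ℕ}

/-- The probability that one of the first `K` rounds succeeds. -/
def successProb (alg : Algorithm l m n)
    (O : Access (Nat.clog 2 l) (Nat.clog 2 m) (Nat.clog 2 n)) (K : ℕ) : ℝ :=
  1 - ∏ j ∈ Finset.range K, (1 - (alg j).successProb O)

/-- The total time of the first `K` rounds, when a state preparation takes time `τ`. -/
def time (alg : Algorithm l m n) (τ : ℝ) (K : ℕ) : ℝ :=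
  ∑ j ∈ Finset.range K, (alg j).time τ

end Algorithm

end QMatMul

end

/-!
Prepare `|B⟩` and, next to it, the norms of the rows of `A`, and undo the preparation of the rows of
`A`. The component of the result with `|0⟩` in the register of column indices of `A` is
`sin θ • |AB⟩`, where `sin θ = ‖AB‖ / (‖A‖ ‖B‖)`. Then `j` steps of amplitude amplification turn
`sin θ` into `± sin ((2 j + 1) θ)` and leave the direction `|AB⟩` unchanged, so a successful round
outputs `|AB⟩` exactly, and `κ` and `ε` enter the time bound only through `1 ≤ κ` and `ε ≤ 1`. The
angle `θ` need not be known: with `2 j + 1 = 3 ^ e` for `e = 0, 1, 2, …`, some `3 ^ e θ` lies in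
`[π / 6, π / 2]`, where a round succeeds with probability at least `1 / 4`, and repeating each round
`O (log (1 / δ))` times makes failure unlikely.
-/

noncomputable section

namespace QMatMul

open scoped Matrix

/-! ### Operators on some of the qubits -/

section ApplyOn

lemma extend_comp_self {ι W α : Type*} (e : ι ↪ W) (x : W → α) :
    Function.extend e (x ∘ e) x = x := by
  funext v
  by_cases h : ∃ i, e i = v
  · obtain ⟨i, rfl⟩ := h
    simp [e.injective.extend_apply]
  · simp [Function.extend_apply' _ _ _ h]

lemma extend_extend {ι W α : Type*} (e : ι ↪ W) (y y' : ι → α) (x : W → α) :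
    Function.extend e y' (Function.extend e y x) = Function.extend e y' x := by
  funext v
  by_cases h : ∃ i, e i = v
  · obtain ⟨i, rfl⟩ := h
    simp [e.injective.extend_apply]
  · simp [Function.extend_apply' _ _ _ h]

lemma extend_update_comp {ι W α : Type*} [DecidableEq ι] [DecidableEq W] (e : ι ↪ W) (x : W → α)
    (i : ι) (b : α) :
    Function.extend e (Function.update (x ∘ e) i b) x = Function.update x (e i) b := by
  rw [← Function.update_comp_eq_of_injective x e.injective]
  funext v
  by_cases h : ∃ j, e j = v
  · obtain ⟨j, rfl⟩ := h
    simp [e.injective.extend_apply]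
  · have hv : v ≠ e i := fun hv => h ⟨i, hv.symm⟩
    simp [Function.extend_apply' _ _ _ h, hv]

variable {ι W : Type} [Fintype ι] [DecidableEq ι]

lemma applyOn_one (e : ι ↪ W) (ψ : State W) : applyOn e 1 ψ = ψ := by
  funext x
  simp [applyOn, Matrix.one_apply, extend_comp_self]

lemma applyOn_applyOn (e : ι ↪ W) (U V : Matrix (Bits ι) (Bits ι) ℂ) (ψ : State W) :
    applyOn e U (applyOn e V ψ) = applyOn e (U * V) ψ := by
  funext x
  simp only [applyOn, Function.extend_comp e.injective, extend_extend, Matrix.mul_apply,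
    Finset.mul_sum, Finset.sum_mul]
  rw [Finset.sum_comm]
  simp only [mul_assoc]

lemma isLinearMap_applyOn (e : ι ↪ W) (U : Matrix (Bits ι) (Bits ι) ℂ) :
    IsLinearMap ℂ (applyOn e U) where
  map_add φ ψ := by
    funext x
    simp [applyOn, mul_add, Finset.sum_add_distrib]
  map_smul c ψ := by
    funext x
    simp [applyOn, Finset.mul_sum, mul_left_comm]

lemma applyOn_of_permutation (e : ι ↪ W) {U : Matrix (Bits ι) (Bits ι) ℂ} {f : Bits ι → Bits ι}
    (hU : ∀ x y, U x y = if y = f x then 1 else 0) (ψ : State W) (x : Bits W) :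
    applyOn e U ψ x = ψ (Function.extend e (f (x ∘ e)) x) := by
  simp [applyOn, hU]

lemma applyOn_diagonal (e : ι ↪ W) (d : Bits ι → ℂ) (ψ : State W) (x : Bits W) :
    applyOn e (Matrix.diagonal d) ψ x = d (x ∘ e) * ψ x := by
  simp [applyOn, Matrix.diagonal_apply, extend_comp_self]

lemma star_applyOn_dotProduct [Fintype W] [DecidableEq W] (e : ι ↪ W)
    (U : Matrix (Bits ι) (Bits ι) ℂ) (φ χ : State W) :
    star (applyOn e U φ) ⬝ᵥ χ = star φ ⬝ᵥ applyOn e (star U) χ := by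
  simp only [dotProduct, applyOn, Pi.star_apply, star_sum, Finset.sum_mul, Finset.mul_sum,
    ← Fintype.sum_prod_type']
  -- exchange the labels of the qubits in the range of `e` between the two summation variables
  refine Finset.sum_nbij' (fun z => (Function.extend e z.2 z.1, z.1 ∘ e))
    (fun z => (Function.extend e z.2 z.1, z.1 ∘ e)) (by simp) (by simp) ?_ ?_ ?_
  · rintro ⟨x, y⟩ _
    simp [Function.extend_comp e.injective, extend_extend, extend_comp_self]
  · rintro ⟨x, y⟩ _
    simp [Function.extend_comp e.injective, extend_extend, extend_comp_self]
  · rintro ⟨x, y⟩ _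
    simp only [Function.extend_comp e.injective, extend_extend, extend_comp_self,
      Matrix.star_apply, star_mul']
    ring

end ApplyOn

section States

variable {W : Type} [Fintype W] [DecidableEq W]

lemma star_ketZero_dotProduct (χ : State W) : star (ketZero W) ⬝ᵥ χ = χ (zeros W) := by
  simp [dotProduct, ketZero]

lemma stateNorm_sq (ψ : State W) : stateNorm ψ ^ 2 = ∑ x, ‖ψ x‖ ^ 2 := by
  simp [stateNorm, EuclideanSpace.norm_sq_eq]

lemma stateNorm_smul (c : ℂ) (ψ : State W) : stateNorm (c • ψ) = ‖c‖ * stateNorm ψ := by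
  simp [stateNorm, norm_smul]

lemma star_dotProduct_self (ψ : State W) : star ψ ⬝ᵥ ψ = ((stateNorm ψ ^ 2 : ℝ) : ℂ) := by
  simp only [stateNorm_sq, dotProduct, Pi.star_apply, Complex.ofReal_sum, Complex.ofReal_pow]
  exact Finset.sum_congr rfl fun x _ => Complex.conj_mul' _

lemma isClose_smul {c : ℂ} (hc : ‖c‖ = 1) (χ : State W) : IsClose 0 (c • χ) χ :=
  ⟨c, hc, by simp [stateNorm]⟩

lemma IsClose.mono {ε ε' : ℝ} {ψ χ : State W} (h : IsClose ε ψ χ) (hε : ε ≤ ε') :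
    IsClose ε' ψ χ :=
  let ⟨c, hc, hψ⟩ := h
  ⟨c, hc, hψ.trans hε⟩

end States

/-! ### Circuits -/

section Circuits

variable {p q r : ℕ} {W : Type}

/-- The action of a circuit, its first gate acting first. -/
def run (O : Access p q r) (c : List (Gate p q r W)) (ψ : State W) : State W :=
  c.foldl (fun ψ g => g.act O ψ) ψ

/-- The total time of the gates of a circuit, when a state preparation takes time `τ`. -/
def gateTime (τ : ℝ) (c : List (Gate p q r W)) : ℝ := (c.map (Gate.time τ)).sum

@[simp] lemma run_nil (O : Access p q r) (ψ : State W) : run O [] ψ = ψ := rfl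

@[simp] lemma run_cons (O : Access p q r) (g : Gate p q r W) (c : List (Gate p q r W))
    (ψ : State W) : run O (g :: c) ψ = run O c (g.act O ψ) := rfl

@[simp] lemma run_append (O : Access p q r) (c d : List (Gate p q r W)) (ψ : State W) :
    run O (c ++ d) ψ = run O d (run O c ψ) := by
  simp [run]

@[simp] lemma gateTime_nil (τ : ℝ) : gateTime τ ([] : List (Gate p q r W)) = 0 := rfl

@[simp] lemma gateTime_cons (τ : ℝ) (g : Gate p q r W) (c : List (Gate p q r W)) :
    gateTime τ (g :: c) = g.time τ + gateTime τ c := by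
  simp [gateTime]

@[simp] lemma gateTime_append (τ : ℝ) (c d : List (Gate p q r W)) :
    gateTime τ (c ++ d) = gateTime τ c + gateTime τ d := by
  simp [gateTime]

lemma isLinearMap_act (O : Access p q r) (g : Gate p q r W) : IsLinearMap ℂ (g.act O) := by
  cases g <;> exact isLinearMap_applyOn _ _

lemma isLinearMap_run (O : Access p q r) (c : List (Gate p q r W)) : IsLinearMap ℂ (run O c) := by
  induction c with
  | nil => exact IsLinearMap.mk (fun _ _ => rfl) fun _ _ => rfl
  | cons g c ih =>
    exact ⟨fun φ ψ => by simp [(isLinearMap_act O g).map_add, ih.map_add],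
      fun z ψ => by simp [(isLinearMap_act O g).map_smul, ih.map_smul]⟩

/-- The state vanishes on the basis labels with a `1` at some qubit in `N`, that is, the qubits in
`N` are all in `|0⟩`. -/
def Clean (N : Set W) (ψ : State W) : Prop := ∀ x, ∀ v ∈ N, x v = true → ψ x = 0

lemma Clean.mono {N N' : Set W} {ψ : State W} (h : Clean N ψ) (hN : N' ⊆ N) : Clean N' ψ :=
  fun x v hv => h x v (hN hv)

lemma clean_ketZero [Fintype W] (N : Set W) : Clean N (ketZero W) := by
  rintro x v - hv
  have hx : x ≠ zeros W := by rintro rfl; simp [zeros] at hv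
  simp [ketZero, hx]

lemma Clean.applyOn {ι : Type} [Fintype ι] [DecidableEq ι] {N : Set W} {ψ : State W}
    (h : Clean N ψ) (e : ι ↪ W) (U : Matrix (Bits ι) (Bits ι) ℂ) (he : ∀ i, e i ∉ N) :
    Clean N (applyOn e U ψ) := by
  intro x v hv hxv
  refine Finset.sum_eq_zero fun y _ => ?_
  rw [h _ v hv, mul_zero]
  rwa [Function.extend_apply' _ _ _ (by rintro ⟨i, rfl⟩; exact he i hv)]

/-- The circuits `c` and `d` act as operators that are inverse and adjoint to each other, and both
keep the qubits in `N` in `|0⟩`. -/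
structure InversePair [Fintype W] [DecidableEq W] (O : Access p q r) (N : Set W)
    (c d : List (Gate p q r W)) : Prop where
  left : ∀ ψ, run O d (run O c ψ) = ψ
  right : ∀ ψ, run O c (run O d ψ) = ψ
  adjoint : ∀ φ χ, star (run O c φ) ⬝ᵥ χ = star φ ⬝ᵥ run O d χ
  clean_left : ∀ ψ, Clean N ψ → Clean N (run O c ψ)
  clean_right : ∀ ψ, Clean N ψ → Clean N (run O d ψ)

section InversePair

variable [Fintype W] [DecidableEq W] {O : Access p q r} {N : Set W}

lemma InversePair.append {c d c' d' : List (Gate p q r W)} (h : InversePair O N c d)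
    (h' : InversePair O N c' d') : InversePair O N (c ++ c') (d' ++ d) where
  left ψ := by simp [h.left, h'.left]
  right ψ := by simp [h.right, h'.right]
  adjoint φ χ := by simp [h.adjoint, h'.adjoint]
  clean_left ψ hψ := by simpa using h'.clean_left _ (h.clean_left _ hψ)
  clean_right ψ hψ := by simpa using h.clean_right _ (h'.clean_right _ hψ)

lemma inversePair_of_unitary {ι : Type} [Fintype ι] [DecidableEq ι] {g g' : Gate p q r W}
    (e : ι ↪ W) (he : ∀ i, e i ∉ N) {U : Matrix (Bits ι) (Bits ι) ℂ}
    (hU : U ∈ Matrix.unitaryGroup (Bits ι) ℂ) (hg : g.act O = applyOn e U)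
    (hg' : g'.act O = applyOn e (star U)) : InversePair O N [g] [g'] where
  left ψ := by simp [hg, hg', applyOn_applyOn, Matrix.mem_unitaryGroup_iff'.1 hU, applyOn_one]
  right ψ := by simp [hg, hg', applyOn_applyOn, Matrix.mem_unitaryGroup_iff.1 hU, applyOn_one]
  adjoint φ χ := by simp [hg, hg', star_applyOn_dotProduct]
  clean_left ψ hψ := by simpa [hg] using hψ.applyOn e U he
  clean_right ψ hψ := by simpa [hg'] using hψ.applyOn e (star U) he

lemma InversePair.run_ketZero_unit {c d : List (Gate p q r W)} (h : InversePair O N c d) :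
    star (run O c (ketZero W)) ⬝ᵥ run O c (ketZero W) = 1 := by
  rw [h.adjoint, h.left, star_ketZero_dotProduct, ketZero, if_pos rfl]

end InversePair

end Circuits

section ElementaryGates

variable {p q r : ℕ} {W : Type}

/-- The single qubit `w`, as a place to apply a one-qubit gate. -/
def qubit (w : W) : Fin 1 ↪ W := ⟨fun _ => w, fun _ _ _ => Subsingleton.elim _ _⟩

/-- The gate `diag(1, -1) = T ^ 4` on the qubit `w`. -/
def signGate (w : W) : List (Gate p q r W) := List.replicate 4 (Gate.T (qubit w))

/-- The Toffoli gate with controls `a`, `b` and target `c`. The list is empty when the three qubits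
are not distinct. -/
def toffoli [DecidableEq W] (a b c : W) : List (Gate p q r W) :=
  if h : Function.Injective ![a, b, c] then [Gate.Toffoli ⟨_, h⟩] else []

lemma run_signGate (O : Access p q r) (w : W) (ψ : State W) (x : Bits W) :
    run O (signGate w) ψ x = (if x w then -1 else 1) * ψ x := by
  have hT : ∀ φ : State W, ∀ x, (Gate.T (qubit w)).act O φ x =
      (if x w then Complex.exp (Complex.I * Real.pi / 4) else 1) * φ x := fun φ x =>
    applyOn_diagonal _ _ _ _
  have hexp : Complex.exp (Complex.I * Real.pi / 4) ^ 4 = -1 := by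
    rw [← Complex.exp_nat_mul, ← Complex.exp_pi_mul_I]
    congr 1
    push_cast
    ring
  simp only [signGate, List.replicate, run_cons, run_nil, hT]
  split_ifs
  · rw [← hexp]
    ring
  · simp

variable [DecidableEq W]

lemma run_X (O : Access p q r) (w : W) (ψ : State W) (x : Bits W) :
    run O [Gate.X (qubit w)] ψ x = ψ (Function.update x w (!x w)) := by
  have hiff : ∀ y z : Fin 1 → Bool, y 0 = (!z 0) ↔ z = Function.update y 0 (!y 0) := by decide
  have hX : ∀ y z : Bits (Fin 1), matX y z = if z = Function.update y 0 (!y 0) then 1 else 0 :=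
    fun y z => by simp only [matX, hiff]
  change applyOn (qubit w) matX ψ x = _
  rw [applyOn_of_permutation _ hX, extend_update_comp]
  rfl

lemma run_H (O : Access p q r) (w : W) (ψ : State W) (x : Bits W) :
    run O [Gate.H (qubit w)] ψ x = (ψ (Function.update x w false) +
      (if x w then -1 else 1) * ψ (Function.update x w true)) / (√2 : ℝ) := by
  have hext : ∀ b : Bool, Function.extend (qubit w) (fun _ => b) x = Function.update x w b := by
    intro b
    rw [← show qubit w 0 = w from rfl, ← extend_update_comp]
    congr 1
    funext i
    simp [Subsingleton.elim i 0]
  change applyOn (qubit w) matH ψ x = _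
  rw [applyOn, ← (Equiv.funUnique (Fin 1) Bool).symm.sum_comp, Fintype.sum_bool]
  change matH (x ∘ qubit w) (fun _ => true) * ψ (Function.extend (qubit w) (fun _ => true) x) +
    matH (x ∘ qubit w) (fun _ => false) * ψ (Function.extend (qubit w) (fun _ => false) x) = _
  rw [hext, hext]
  have hw : (x ∘ qubit w) 0 = x w := rfl
  simp only [matH, hw, Bool.and_true, Bool.and_false, Bool.false_eq_true, if_false]
  ring

lemma run_toffoli (O : Access p q r) {a b c : W} (hab : a ≠ b) (hac : a ≠ c) (hbc : b ≠ c)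
    (ψ : State W) (x : Bits W) :
    run O (toffoli a b c) ψ x = ψ (Function.update x c (x c ^^ (x a && x b))) := by
  have hinj : Function.Injective ![a, b, c] := by
    simp [Function.Injective, Fin.forall_fin_succ, hab, hac, hbc, hab.symm, hac.symm, hbc.symm]
  have hiff : ∀ y z : Fin 3 → Bool, (y 0 = z 0 ∧ y 1 = z 1 ∧ y 2 = (z 2 ^^ (z 0 && z 1))) ↔
      z = Function.update y 2 (y 2 ^^ (y 0 && y 1)) := by decide
  have hT : ∀ y z : Bits (Fin 3), matToffoli y z =
      if z = Function.update y 2 (y 2 ^^ (y 0 && y 1)) then 1 else 0 := fun y z => by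
    simp only [matToffoli, hiff]
  simp only [toffoli, dif_pos hinj, run_cons, run_nil, Gate.act]
  rw [applyOn_of_permutation _ hT, extend_update_comp]
  rfl

lemma gateTime_toffoli_le (τ : ℝ) (a b c : W) :
    gateTime τ (toffoli a b c : List (Gate p q r W)) ≤ 1 := by
  unfold toffoli
  split_ifs <;> simp [Gate.time]

end ElementaryGates

/-! ### Sign flips -/

section SignFlips

variable {p q r : ℕ} {W : Type} [DecidableEq W]

/-- The permutation of basis labels that adds the conjunction of `c` and the negation of `w` to the
qubit `a`. -/
def andNot (w c a : W) (x : Bits W) : Bits W := Function.update x a (x a ^^ (!x w && x c))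

lemma andNot_of_ne {w c a v : W} (hv : v ≠ a) (x : Bits W) : andNot w c a x v = x v :=
  Function.update_of_ne hv _ _

lemma andNot_andNot {w c a : W} (hw : w ≠ a) (hc : c ≠ a) (x : Bits W) :
    andNot w c a (andNot w c a x) = x := by
  simp [andNot, hw, hc]

/-- A circuit for `andNot`. -/
def andNotCircuit (w c a : W) : List (Gate p q r W) :=
  Gate.X (qubit w) :: (toffoli w c a ++ [Gate.X (qubit w)])

lemma run_andNotCircuit (O : Access p q r) {w c a : W} (hwc : w ≠ c) (hwa : w ≠ a) (hca : c ≠ a)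
    (ψ : State W) : run O (andNotCircuit w c a) ψ = ψ ∘ andNot w c a := by
  funext x
  rw [andNotCircuit, ← List.singleton_append, run_append, run_append, run_X,
    run_toffoli O hwc hwa hca, run_X]
  simp [andNot, hwc.symm, hwa, hwa.symm, Function.update_comm hwa.symm]

lemma gateTime_andNotCircuit_le (τ : ℝ) (w c a : W) :
    gateTime τ (andNotCircuit w c a : List (Gate p q r W)) ≤ 3 := by
  have h := gateTime_toffoli_le (p := p) (q := q) (r := r) τ w c a
  simp only [andNotCircuit, gateTime_cons, gateTime_append, gateTime_nil, Gate.time]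
  linarith

variable {ι : Type} {reg anc : ι → W}

/-- The circuit that changes the sign of the basis labels with a `1` at the qubit `c` and a `0` at
the qubits `reg i`, for `i` in a list. Each `anc i` is computed and uncomputed as an
intermediate conjunction. -/
def signFlipCircuit (reg anc : ι → W) : W → List ι → List (Gate p q r W)
  | c, [] => signGate c
  | c, i :: is => andNotCircuit (reg i) c (anc i) ++
      (signFlipCircuit reg anc (anc i) is ++ andNotCircuit (reg i) c (anc i))

lemma run_signFlipCircuit (O : Access p q r) (hanc : Function.Injective anc)
    (hra : ∀ i j, reg i ≠ anc j) {is : List ι} (his : is.Nodup) {c : W}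
    (hrc : ∀ i ∈ is, reg i ≠ c) (hca : ∀ i ∈ is, c ≠ anc i) {ψ : State W}
    (hψ : Clean (anc '' {i | i ∈ is}) ψ) (x : Bits W) :
    run O (signFlipCircuit reg anc c is) ψ x =
      (if x c ∧ ∀ i ∈ is, x (reg i) = false then -1 else 1) * ψ x := by
  induction is generalizing c ψ x with
  | nil => simp [signFlipCircuit, run_signGate]
  | cons i is ih =>
    obtain ⟨hi, his⟩ := List.nodup_cons.1 his
    rw [List.forall_mem_cons] at hrc hca
    have hne : ∀ j ∈ is, anc j ≠ anc i := fun j hj h => hi (hanc h ▸ hj)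
    have hrun := run_andNotCircuit O hrc.1 (hra i i) hca.1
    have hclean : Clean (anc '' {j | j ∈ is}) (ψ ∘ andNot (reg i) c (anc i)) := by
      rintro y _ ⟨j, hj, rfl⟩ hy
      refine hψ _ (anc j) ⟨j, List.mem_cons_of_mem _ hj, rfl⟩ ?_
      rwa [andNot_of_ne (hne j hj)]
    simp only [signFlipCircuit, run_append, hrun, Function.comp_apply]
    rw [ih his (fun j _ => hra j i) (fun j hj => (hne j hj).symm) hclean, Function.comp_apply,
      andNot_andNot (hra i i) hca.1]
    cases hx : x (anc i) with
    | true => simp [hψ x _ ⟨i, List.mem_cons_self, rfl⟩ hx]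
    | false =>
      have ha : andNot (reg i) c (anc i) x (anc i) = (!x (reg i) && x c) := by simp [andNot, hx]
      simp [andNot_of_ne (hra _ i), ha, and_assoc, and_left_comm]

lemma gateTime_signFlipCircuit_le (τ : ℝ) (c : W) (is : List ι) :
    gateTime τ (signFlipCircuit reg anc c is : List (Gate p q r W)) ≤ 6 * is.length + 4 := by
  induction is generalizing c with
  | nil => norm_num [signFlipCircuit, signGate, List.replicate, Gate.time]
  | cons i is ih =>
    have h := gateTime_andNotCircuit_le (p := p) (q := q) (r := r) τ (reg i) c (anc i)
    have hi := ih (anc i)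
    simp only [signFlipCircuit, gateTime_append, List.length_cons, Nat.cast_add, Nat.cast_one]
    linarith

end SignFlips

/-! ### Reflections and flags -/

/-- The qubits of a circuit that tests whether some of the register qubits are in `|0⟩`: the
register, an ancilla qubit for each register qubit, and a flag. -/
structure Workspace (ι W : Type) where
  register : ι → W
  ancilla : ι → W
  flag : W
  ancilla_injective : Function.Injective ancilla
  register_ne_ancilla : ∀ i j, register i ≠ ancilla j
  register_ne_flag : ∀ i, register i ≠ flag
  flag_ne_ancilla : ∀ i, flag ≠ ancilla i
  cover : ∀ w, w ∈ Set.range register ∨ w ∈ insert flag (Set.range ancilla)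

namespace Workspace

variable {p q r : ℕ} {ι W : Type} (L : Workspace ι W)

/-- The flag and the ancilla qubits, which are in `|0⟩` except while a test is performed. -/
def idle : Set W := insert L.flag (Set.range L.ancilla)

lemma range_ancilla_subset_idle : Set.range L.ancilla ⊆ L.idle := Set.subset_insert _ _

lemma register_notMem_idle (i : ι) : L.register i ∉ L.idle := by
  rintro (h | ⟨j, h⟩)
  · exact L.register_ne_flag i h
  · exact L.register_ne_ancilla i j h.symm

lemma eq_zeros_of_register {x : Bits W} (hidle : ∀ w ∈ L.idle, x w = false)
    (hx : ∀ i, x (L.register i) = false) : x = zeros W := by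
  funext w
  rcases L.cover w with ⟨i, rfl⟩ | hw
  exacts [hx i, hidle w hw]

section DecidableEq

variable [DecidableEq W]

/-- The sign flip of the basis labels with flag `1` and `0` at the register qubits in `S`. -/
def signFlip (S : Finset ι) : List (Gate p q r W) :=
  signFlipCircuit L.register L.ancilla L.flag S.toList

lemma run_signFlip (O : Access p q r) (S : Finset ι) {ψ : State W}
    (hψ : Clean (Set.range L.ancilla) ψ) (x : Bits W) :
    run O (L.signFlip S) ψ x =
      (if x L.flag ∧ ∀ i ∈ S, x (L.register i) = false then -1 else 1) * ψ x := by
  rw [signFlip, run_signFlipCircuit O L.ancilla_injective L.register_ne_ancilla S.nodup_toList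
    (fun i _ => L.register_ne_flag i) (fun i _ => L.flag_ne_ancilla i)
    (hψ.mono (Set.image_subset_range _ _))]
  simp only [Finset.mem_toList]

lemma gateTime_signFlip_le [Fintype ι] (τ : ℝ) (S : Finset ι) :
    gateTime τ (L.signFlip S : List (Gate p q r W)) ≤ 6 * Fintype.card ι + 4 := by
  refine (gateTime_signFlipCircuit_le _ _ _).trans ?_
  rw [Finset.length_toList]
  gcongr
  exact S.card_le_univ

/-- A circuit for the reflection `1 - 2 P`, where `P` is `zeroProj S`, on states whose flag and
ancilla qubits are in `|0⟩`. -/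
def reflectCircuit (S : Finset ι) : List (Gate p q r W) :=
  Gate.X (qubit L.flag) :: (L.signFlip S ++ [Gate.X (qubit L.flag)])

/-- A circuit that sets the flag when the register qubits in `S` are in `|0⟩`: a Hadamard test of
`signFlip`. -/
def flagCircuit (S : Finset ι) : List (Gate p q r W) :=
  Gate.H (qubit L.flag) :: (L.signFlip S ++ [Gate.H (qubit L.flag)])

variable {L}

lemma gateTime_reflectCircuit_le [Fintype ι] (τ : ℝ) (S : Finset ι) :
    gateTime τ (L.reflectCircuit S : List (Gate p q r W)) ≤ 6 * Fintype.card ι + 6 := by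
  have h := L.gateTime_signFlip_le (p := p) (q := q) (r := r) τ S
  simp only [reflectCircuit, gateTime_cons, gateTime_append, gateTime_nil, Gate.time]
  linarith

lemma gateTime_flagCircuit_le [Fintype ι] (τ : ℝ) (S : Finset ι) :
    gateTime τ (L.flagCircuit S : List (Gate p q r W)) ≤ 6 * Fintype.card ι + 6 := by
  have h := L.gateTime_signFlip_le (p := p) (q := q) (r := r) τ S
  simp only [flagCircuit, gateTime_cons, gateTime_append, gateTime_nil, Gate.time]
  linarith

lemma run_reflectCircuit_apply (O : Access p q r) (S : Finset ι) {ψ : State W}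
    (hψ : Clean L.idle ψ) (x : Bits W) :
    run O (L.reflectCircuit S) ψ x =
      (if ∀ i ∈ S, x (L.register i) = false then -1 else 1) * ψ x := by
  have hclean : Clean (Set.range L.ancilla) (run O [Gate.X (qubit L.flag)] ψ) := by
    rintro y _ ⟨i, rfl⟩ hy
    rw [run_X, hψ _ _ (L.range_ancilla_subset_idle ⟨i, rfl⟩)]
    rwa [Function.update_of_ne (L.flag_ne_ancilla i).symm]
  rw [reflectCircuit, ← List.singleton_append, run_append, run_append, run_X,
    L.run_signFlip O S hclean, run_X]
  simp only [Function.update_self, Function.update_idem, Bool.not_not, Function.update_eq_self,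
    Function.update_of_ne (L.register_ne_flag _)]
  cases hx : x L.flag with
  | true => simp [hψ x L.flag (Set.mem_insert _ _) hx]
  | false => simp only [Bool.not_false, true_and]

lemma clean_reflectCircuit (O : Access p q r) (S : Finset ι) {ψ : State W}
    (hψ : Clean L.idle ψ) : Clean L.idle (run O (L.reflectCircuit S) ψ) := fun x w hw hx => by
  rw [run_reflectCircuit_apply O S hψ, hψ x w hw hx, mul_zero]

variable [Fintype W]

variable (L) in
/-- The projection onto the states whose register qubits in `S` are in `|0⟩`. -/
def zeroProj (S : Finset ι) : Matrix (Bits W) (Bits W) ℂ :=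
  Matrix.diagonal fun x => if ∀ i ∈ S, x (L.register i) = false then 1 else 0

lemma isStarProjection_zeroProj (S : Finset ι) : IsStarProjection (L.zeroProj S) where
  isIdempotentElem := by
    simp [IsIdempotentElem, zeroProj]
  isSelfAdjoint := by
    rw [IsSelfAdjoint, Matrix.star_eq_conjTranspose, zeroProj, Matrix.diagonal_conjTranspose]
    congr 1
    funext x
    simp [apply_ite]

lemma zeroProj_mulVec (S : Finset ι) (ψ : State W) (x : Bits W) :
    (L.zeroProj S *ᵥ ψ) x = if ∀ i ∈ S, x (L.register i) = false then ψ x else 0 := by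
  simp [zeroProj, Matrix.mulVec_diagonal]

lemma run_flagCircuit_of_flag (O : Access p q r) (S : Finset ι) {ψ : State W}
    (hψ : Clean L.idle ψ) {x : Bits W} (hx : x L.flag = true) :
    run O (L.flagCircuit S) ψ x =
      (L.zeroProj S *ᵥ ψ) (Function.update x L.flag false) := by
  have hH : ∀ y, run O [Gate.H (qubit L.flag)] ψ y =
      ψ (Function.update y L.flag false) / (√2 : ℝ) := fun y => by
    rw [run_H, hψ (Function.update y L.flag true) L.flag (Set.mem_insert _ _) (by simp), mul_zero,
      add_zero]
  have hclean : Clean (Set.range L.ancilla) (run O [Gate.H (qubit L.flag)] ψ) := by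
    rintro y _ ⟨i, rfl⟩ hy
    rw [hH, hψ _ _ (L.range_ancilla_subset_idle ⟨i, rfl⟩), zero_div]
    rwa [Function.update_of_ne (L.flag_ne_ancilla i).symm]
  have hsqrt : ((√2 : ℝ) : ℂ) * (√2 : ℝ) = 2 := by
    rw [← Complex.ofReal_mul, Real.mul_self_sqrt zero_le_two, Complex.ofReal_ofNat]
  rw [flagCircuit, ← List.singleton_append, run_append, run_append, run_H,
    L.run_signFlip O S hclean, L.run_signFlip O S hclean, hH, hH]
  simp only [zeroProj_mulVec, Function.update_self, Function.update_idem, Bool.false_eq_true,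
    false_and, if_false, true_and, hx, if_true, Function.update_of_ne (L.register_ne_flag _),
    one_mul]
  split_ifs
  · rw [neg_one_mul, neg_one_mul, neg_neg, ← two_mul, ← mul_div_assoc, div_div, hsqrt,
      mul_div_cancel_left₀ _ two_ne_zero]
  · ring

lemma run_reflectCircuit (O : Access p q r) (S : Finset ι) {ψ : State W} (hψ : Clean L.idle ψ) :
    run O (L.reflectCircuit S) ψ = ψ - (2 : ℂ) • L.zeroProj S *ᵥ ψ := by
  funext x
  simp only [run_reflectCircuit_apply O S hψ, Pi.sub_apply, Pi.smul_apply, smul_eq_mul,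
    zeroProj_mulVec]
  split_ifs <;> ring

lemma zeroProj_univ_mulVec [Fintype ι] {ψ : State W} (hψ : Clean L.idle ψ) :
    L.zeroProj Finset.univ *ᵥ ψ = ψ (zeros W) • ketZero W := by
  funext x
  simp only [zeroProj_mulVec, Finset.mem_univ, forall_const, Pi.smul_apply, smul_eq_mul, ketZero]
  by_cases hx : x = zeros W
  · subst hx
    simp [zeros]
  · rw [if_neg hx, mul_zero]
    split_ifs with hreg
    · by_contra hne
      refine hx (L.eq_zeros_of_register (fun w hw => ?_) hreg)
      exact Bool.eq_false_iff.2 fun h => hne (hψ x w hw h)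
    · rfl

end DecidableEq

end Workspace

/-! ### Amplitude amplification -/

section Grover

variable {N : Type*} [Fintype N] [DecidableEq N]

/-- The iteration matrix of amplitude amplification, `(1 - 2 |ψ⟩⟨ψ|) (1 - 2 P)`: up to sign, a
rotation of the plane spanned by `P ψ` and `ψ - P ψ`. -/
def groverMatrix (P : Matrix N N ℂ) (ψ : N → ℂ) : Matrix N N ℂ :=
  (1 - (2 : ℂ) • Matrix.vecMulVec ψ (star ψ)) * (1 - (2 : ℂ) • P)

lemma groverMatrix_mulVec (P : Matrix N N ℂ) (ψ φ : N → ℂ) :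
    groverMatrix P ψ *ᵥ φ = (φ - (2 : ℂ) • P *ᵥ φ) -
      (2 * (star ψ ⬝ᵥ (φ - (2 : ℂ) • P *ᵥ φ))) • ψ := by
  simp only [groverMatrix, ← Matrix.mulVec_mulVec, Matrix.sub_mulVec, Matrix.one_mulVec,
    Matrix.smul_mulVec, Matrix.vecMulVec_mulVec, op_smul_eq_smul, smul_smul]

variable {P : Matrix N N ℂ} {ψ : N → ℂ} {θ : ℝ}

lemma groverMatrix_mulVec_combination (hP : IsIdempotentElem P) (hψ : star ψ ⬝ᵥ ψ = 1)
    (hθ : star ψ ⬝ᵥ (P *ᵥ ψ) = ((Real.sin θ ^ 2 : ℝ) : ℂ)) (α β : ℝ) :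
    groverMatrix P ψ *ᵥ ((α : ℂ) • P *ᵥ ψ + (β : ℂ) • (ψ - P *ᵥ ψ)) =
      ((-α + 2 * (α * Real.sin θ ^ 2 - β * Real.cos θ ^ 2) : ℝ) : ℂ) • P *ᵥ ψ +
      ((β + 2 * (α * Real.sin θ ^ 2 - β * Real.cos θ ^ 2) : ℝ) : ℂ) • (ψ - P *ᵥ ψ) := by
  have hPP : P *ᵥ (P *ᵥ ψ) = P *ᵥ ψ := by rw [Matrix.mulVec_mulVec, hP]
  have hcos : star ψ ⬝ᵥ (ψ - P *ᵥ ψ) = ((Real.cos θ ^ 2 : ℝ) : ℂ) := by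
    rw [dotProduct_sub, hψ, hθ, Real.cos_sq', Complex.ofReal_sub, Complex.ofReal_one]
  have hreflect : (α : ℂ) • P *ᵥ ψ + (β : ℂ) • (ψ - P *ᵥ ψ) -
      (2 : ℂ) • P *ᵥ ((α : ℂ) • P *ᵥ ψ + (β : ℂ) • (ψ - P *ᵥ ψ)) =
      (-α : ℂ) • P *ᵥ ψ + (β : ℂ) • (ψ - P *ᵥ ψ) := by
    rw [Matrix.mulVec_add, Matrix.mulVec_smul, Matrix.mulVec_smul, Matrix.mulVec_sub, hPP,
      sub_self, smul_zero, add_zero]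
    module
  rw [groverMatrix_mulVec, hreflect, dotProduct_add, dotProduct_smul, dotProduct_smul, hθ, hcos]
  push_cast [smul_eq_mul]
  module

lemma exists_groverMatrix_pow_mulVec (hP : IsIdempotentElem P) (hψ : star ψ ⬝ᵥ ψ = 1)
    (hθ : star ψ ⬝ᵥ (P *ᵥ ψ) = ((Real.sin θ ^ 2 : ℝ) : ℂ)) (j : ℕ) :
    ∃ α β : ℝ, (groverMatrix P ψ ^ j) *ᵥ ψ = (α : ℂ) • P *ᵥ ψ + (β : ℂ) • (ψ - P *ᵥ ψ) ∧
      α * Real.sin θ = (-1) ^ j * Real.sin ((2 * j + 1) * θ) ∧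
      β * Real.cos θ = (-1) ^ j * Real.cos ((2 * j + 1) * θ) := by
  induction j with
  | zero => exact ⟨1, 1, by simp, by simp, by simp⟩
  | succ j ih =>
    obtain ⟨α, β, hG, hα, hβ⟩ := ih
    have hangle : (2 * ((j + 1 : ℕ) : ℝ) + 1) * θ = (2 * j + 1) * θ + 2 * θ := by
      push_cast
      ring
    refine ⟨_, _, by rw [pow_succ', ← Matrix.mulVec_mulVec, hG,
      groverMatrix_mulVec_combination hP hψ hθ], ?_, ?_⟩
    · rw [hangle, Real.sin_add, Real.sin_two_mul, Real.cos_two_mul]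
      linear_combination (2 * Real.sin θ ^ 2 - 1) * hα - 2 * Real.sin θ * Real.cos θ * hβ +
        2 * (-1) ^ j * Real.sin ((2 * j + 1) * θ) * Real.sin_sq_add_cos_sq θ
    · rw [hangle, Real.cos_add, Real.sin_two_mul, Real.cos_two_mul]
      linear_combination 2 * Real.sin θ * Real.cos θ * hα + (1 - 2 * Real.cos θ ^ 2) * hβ

theorem mulVec_groverMatrix_pow_mulVec (hP : IsStarProjection P) (hψ : star ψ ⬝ᵥ ψ = 1)
    {g : N → ℂ} (hg : star g ⬝ᵥ g = 1) (hPψ : P *ᵥ ψ = (Real.sin θ : ℂ) • g) (j : ℕ) :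
    P *ᵥ (groverMatrix P ψ ^ j *ᵥ ψ) =
      (((-1) ^ j * Real.sin ((2 * j + 1) * θ) : ℝ) : ℂ) • g := by
  have hPP : P *ᵥ (P *ᵥ ψ) = P *ᵥ ψ := by rw [Matrix.mulVec_mulVec, hP.isIdempotentElem]
  have hstar : star (P *ᵥ ψ) = star ψ ᵥ* P := by
    rw [Matrix.star_mulVec, ← Matrix.star_eq_conjTranspose, hP.isSelfAdjoint]
  have hθ : star ψ ⬝ᵥ (P *ᵥ ψ) = ((Real.sin θ ^ 2 : ℝ) : ℂ) := by
    rw [← hPP, Matrix.dotProduct_mulVec, ← hstar, hPψ, star_smul, smul_dotProduct,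
      dotProduct_smul, hg, Complex.star_def, Complex.conj_ofReal]
    simp [sq]
  obtain ⟨α, β, hG, hα, -⟩ := exists_groverMatrix_pow_mulVec hP.isIdempotentElem hψ hθ j
  rw [hG, Matrix.mulVec_add, Matrix.mulVec_smul, Matrix.mulVec_smul, Matrix.mulVec_sub, hPP,
    sub_self, smul_zero, add_zero, hPψ, smul_smul, ← Complex.ofReal_mul, hα]

end Grover

namespace Workspace

variable {p q r : ℕ} {ι W : Type} [Fintype ι] [DecidableEq W] (L : Workspace ι W)
  (c d : List (Gate p q r W)) (S : Finset ι)

/-- One step of amplitude amplification of the state prepared by `c`, with `d` the inverse of `c`: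
a circuit for `groverMatrix`. -/
def groverCircuit : List (Gate p q r W) :=
  L.reflectCircuit S ++ (d ++ (L.reflectCircuit Finset.univ ++ c))

/-- The state preparation `c`, followed by steps of amplitude amplification. -/
def amplify : ℕ → List (Gate p q r W)
  | 0 => c
  | j + 1 => amplify j ++ L.groverCircuit c d S

variable {c d}

lemma gateTime_amplify_append_flagCircuit_le {τ T : ℝ} (hc : gateTime τ c ≤ T)
    (hd : gateTime τ d ≤ T) (j : ℕ) :
    gateTime τ (L.amplify c d S j ++ L.flagCircuit S) ≤
      (2 * j + 1) * (T + 6 * Fintype.card ι + 6) := by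
  rw [gateTime_append]
  induction j with
  | zero =>
    have hflag := gateTime_flagCircuit_le (L := L) (p := p) (q := q) (r := r) τ S
    simp only [amplify, CharP.cast_eq_zero]
    linarith
  | succ j ih =>
    have hS := gateTime_reflectCircuit_le (L := L) (p := p) (q := q) (r := r) τ S
    have huniv := gateTime_reflectCircuit_le (L := L) (p := p) (q := q) (r := r) τ Finset.univ
    simp only [amplify, groverCircuit, gateTime_append, Nat.cast_add, Nat.cast_one]
    linarith

variable {L S} [Fintype W] {O : Access p q r}

lemma run_groverCircuit (h : InversePair O L.idle c d) {φ : State W} (hφ : Clean L.idle φ) :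
    run O (L.groverCircuit c d S) φ =
      groverMatrix (L.zeroProj S) (run O c (ketZero W)) *ᵥ φ := by
  have hS := clean_reflectCircuit O S hφ
  rw [run_reflectCircuit O S hφ] at hS
  have hd := h.clean_right _ hS
  simp only [groverCircuit, run_append]
  rw [run_reflectCircuit O S hφ, run_reflectCircuit O Finset.univ hd, zeroProj_univ_mulVec hd,
    (isLinearMap_run O c).map_sub, h.right, (isLinearMap_run O c).map_smul,
    (isLinearMap_run O c).map_smul, ← star_ketZero_dotProduct (run O d _), ← h.adjoint,
    groverMatrix_mulVec, smul_smul]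

lemma clean_groverCircuit (h : InversePair O L.idle c d) {φ : State W} (hφ : Clean L.idle φ) :
    Clean L.idle (run O (L.groverCircuit c d S) φ) := by
  simp only [groverCircuit, run_append]
  exact h.clean_left _ (clean_reflectCircuit O _
    (h.clean_right _ (clean_reflectCircuit O S hφ)))

lemma clean_run_amplify (h : InversePair O L.idle c d) (j : ℕ) :
    Clean L.idle (run O (L.amplify c d S j) (ketZero W)) := by
  induction j with
  | zero => exact h.clean_left _ (clean_ketZero _)
  | succ j ih => simpa [amplify] using clean_groverCircuit h ih

lemma run_amplify (h : InversePair O L.idle c d) (j : ℕ) :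
    run O (L.amplify c d S j) (ketZero W) =
      groverMatrix (L.zeroProj S) (run O c (ketZero W)) ^ j *ᵥ run O c (ketZero W) := by
  induction j with
  | zero => simp [amplify]
  | succ j ih =>
    rw [amplify, run_append, run_groverCircuit h (clean_run_amplify h j), ih,
      Matrix.mulVec_mulVec, ← pow_succ']

theorem run_amplify_append_flagCircuit (h : InversePair O L.idle c d) {g : State W}
    (hg : star g ⬝ᵥ g = 1) {θ : ℝ}
    (hc : L.zeroProj S *ᵥ run O c (ketZero W) = (Real.sin θ : ℂ) • g) (j : ℕ) {x : Bits W}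
    (hx : x L.flag = true) :
    run O (L.amplify c d S j ++ L.flagCircuit S) (ketZero W) x =
      (((-1) ^ j * Real.sin ((2 * j + 1) * θ) : ℝ) : ℂ) *
        g (Function.update x L.flag false) := by
  rw [run_append, run_flagCircuit_of_flag O S (clean_run_amplify h j) hx, run_amplify h,
    mulVec_groverMatrix_pow_mulVec (isStarProjection_zeroProj S) h.run_ketZero_unit hg hc,
    Pi.smul_apply, smul_eq_mul]

end Workspace

/-! ### Norms of encoded matrices -/

section Encoding

variable {l m n b c : ℕ}

lemma enc_injective (h : n ≤ 2 ^ b) : Function.Injective (enc b : Fin n → Bits (Fin b)) := by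
  refine fun i j hij => Fin.ext (Nat.eq_of_testBit_eq fun k => ?_)
  by_cases hk : k < b
  · exact congrFun hij ⟨k, hk⟩
  · have hle : 2 ^ b ≤ 2 ^ k := Nat.pow_le_pow_right two_pos (not_lt.1 hk)
    rw [Nat.testBit_lt_two_pow (i.2.trans_le (h.trans hle)),
      Nat.testBit_lt_two_pow (j.2.trans_le (h.trans hle))]

lemma frobenius_norm_sq {ι κ : Type*} [Fintype ι] [Fintype κ] (M : Matrix ι κ ℝ) :
    ‖M‖ ^ 2 = ∑ i, ∑ j, M i j ^ 2 := by
  rw [Matrix.frobenius_norm_def, ← Real.sqrt_eq_rpow, Real.sq_sqrt (by positivity)]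
  simp

lemma ketMat_enc_left (hm : m ≤ 2 ^ b) (M : Matrix (Fin m) (Fin n) ℝ) (i : Fin m)
    (y : Bits (Fin c)) : ketMat b c M (enc b i) y = ketVec c (M i) y := by
  simp [ketMat, ketVec, (enc_injective hm).eq_iff, ite_and, Finset.sum_ite_irrel]

lemma ketVec_enc (hn : n ≤ 2 ^ b) (v : Fin n → ℝ) (j : Fin n) : ketVec b v (enc b j) = v j := by
  simp [ketVec, (enc_injective hn).eq_iff]

lemma sum_norm_ketMat_sq (hm : m ≤ 2 ^ b) (hn : n ≤ 2 ^ c) (M : Matrix (Fin m) (Fin n) ℝ) :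
    ∑ u, ∑ v, ‖ketMat b c M u v‖ ^ 2 = ‖M‖ ^ 2 := by
  rw [frobenius_norm_sq, ← Fintype.sum_prod_type', ← Fintype.sum_prod_type']
  symm
  refine Finset.sum_of_injOn (fun z => (enc b z.1, enc c z.2)) ?_ (by simp) ?_ ?_
  · exact ((enc_injective hm).prodMap (enc_injective hn)).injOn
  · rintro ⟨u, v⟩ - huv
    have hzero : ketMat b c M u v = 0 := by
      refine Finset.sum_eq_zero fun i _ => Finset.sum_eq_zero fun j _ => if_neg ?_
      rintro ⟨rfl, rfl⟩
      exact huv ⟨(i, j), by simp, rfl⟩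
    simp [hzero]
  · rintro ⟨i, j⟩ -
    simp [ketMat_enc_left hm, ketVec_enc hn]

lemma sum_ketVec_mul_ketMat (hm : m ≤ 2 ^ b) (a : Fin m → ℝ) (B : Matrix (Fin m) (Fin n) ℝ)
    (v : Bits (Fin c)) :
    ∑ w, ketVec b a w * ketMat b c B w v = ketVec c (a ᵥ* B) v := by
  have hterm : ∀ w, ketVec b a w * ketMat b c B w v =
      ∑ j, if enc b j = w then (a j : ℂ) * ketVec c (B j) v else 0 := fun w => by
    rw [ketVec, Finset.sum_mul]
    refine Finset.sum_congr rfl fun j _ => ?_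
    split_ifs with hj
    · rw [← hj, ketMat_enc_left hm]
    · rw [zero_mul]
  simp only [hterm]
  rw [Finset.sum_comm]
  simp only [Finset.sum_ite_eq, Finset.mem_univ, if_true, ketVec, Finset.mul_sum]
  rw [Finset.sum_comm]
  refine Finset.sum_congr rfl fun k _ => ?_
  split_ifs <;> simp [Matrix.vecMul, dotProduct]

lemma ketVec_rowNorm_mul_star {A : Matrix (Fin l) (Fin m) ℝ} {u : Bits (Fin b)}
    {φ : State (Fin c)}
    (hφ : ∀ i, enc b i = u → ∀ y, (rowNorm A i : ℂ) * φ y = ketVec c (A i) y)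
    (y : Bits (Fin c)) : ketVec b (rowNorm A) u * star (φ y) = ketMat b c A u y := by
  rw [ketVec, Finset.sum_mul, ketMat]
  refine Finset.sum_congr rfl fun i _ => ?_
  split_ifs with hi
  · have hstar := congrArg star (hφ i hi y)
    rw [star_mul', Complex.star_def, Complex.conj_ofReal] at hstar
    rw [Complex.star_def, hstar]
    simp [ketVec, apply_ite (starRingEnd ℂ), hi]
  · simp [hi]

lemma sum_ketMat_mul_ketMat {d : ℕ} (hm : m ≤ 2 ^ c) (A : Matrix (Fin l) (Fin m) ℝ)
    (B : Matrix (Fin m) (Fin n) ℝ) (u : Bits (Fin b)) (v : Bits (Fin d)) :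
    ∑ w, ketMat b c A u w * ketMat c d B w v = ketMat b d (A * B) u v := by
  have hsplit : ∀ {k e : ℕ} (M : Matrix (Fin l) (Fin k) ℝ) (y : Bits (Fin e)),
      ketMat b e M u y = ∑ i, if enc b i = u then ketVec e (M i) y else 0 := fun M y => by
    simp [ketMat, ketVec, ite_and, Finset.sum_ite_irrel]
  simp only [hsplit, Finset.sum_mul, ite_mul, zero_mul]
  rw [Finset.sum_comm]
  simp only [Finset.sum_ite_irrel, Finset.sum_const_zero, sum_ketVec_mul_ketMat hm]
  rfl

end Encoding

/-! ### Basis labels of the qubits of a round -/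

lemma sum_bits_sum {α β M : Type*} [Fintype α] [Fintype β] [DecidableEq α] [DecidableEq β]
    [AddCommMonoid M] (f : (α ⊕ β → Bool) → M) :
    ∑ y, f y = ∑ a : α → Bool, ∑ b : β → Bool, f (Sum.elim a b) := by
  rw [← Fintype.sum_prod_type' fun (a : α → Bool) (b : β → Bool) => f (Sum.elim a b)]
  exact ((Equiv.sumArrowEquivProdArrow α β Bool).symm.sum_comp f).symm

section Labels

variable {p q r s : ℕ}

/-- The basis label with `u`, `v`, `w` in the registers of `p`, `r`, `q` qubits and `t` in the
other qubits. -/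
def label (u : Bits (Fin p)) (v : Bits (Fin r)) (w : Bits (Fin q)) (t : Bits (Unit ⊕ Fin s)) :
    Bits (Wires p q r s) :=
  Sum.elim u (Sum.elim v (Sum.elim w t))

lemma exists_eq_label (x : Bits (Wires p q r s)) : ∃ u v w t, x = label u v w t := by
  refine ⟨fun i => x (.inl i), fun i => x (.inr (.inl i)), fun i => x (.inr (.inr (.inl i))),
    fun i => x (.inr (.inr (.inr i))), ?_⟩
  funext i
  rcases i with i | i | i | i <;> rfl

lemma ketZero_label (u : Bits (Fin p)) (v : Bits (Fin r)) (w : Bits (Fin q))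
    (t : Bits (Unit ⊕ Fin s)) :
    ketZero (Wires p q r s) (label u v w t) =
      if u = zeros _ ∧ v = zeros _ ∧ w = zeros _ ∧ t = zeros _ then 1 else 0 := by
  have hzeros : zeros (Wires p q r s) = label (zeros _) (zeros _) (zeros _) (zeros _) := by
    funext i
    rcases i with i | i | i | i <;> rfl
  simp only [ketZero, hzeros, label, Sum.elim_eq_iff]

/-- The registers that hold row and column indices of `A`. -/
def embPQ : Fin p ⊕ Fin q ↪ Wires p q r s :=
  ⟨Sum.elim Sum.inl fun i => Sum.inr (Sum.inr (Sum.inl i)), by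
    rintro (i | i) (j | j) h <;> simp_all⟩

/-- The registers that hold row and column indices of `B`. -/
def embQR : Fin q ⊕ Fin r ↪ Wires p q r s :=
  ⟨Sum.elim (fun i => Sum.inr (Sum.inr (Sum.inl i))) fun i => Sum.inr (Sum.inl i), by
    rintro (i | i) (j | j) h <;> simp_all⟩

lemma extend_embPQ (u u' : Bits (Fin p)) (v : Bits (Fin r)) (w w' : Bits (Fin q))
    (t : Bits (Unit ⊕ Fin s)) :
    Function.extend embPQ (Sum.elim u' w') (label u v w t) = label u' v w' t := by
  funext i
  rcases i with i | i | i | i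
  · exact embPQ.injective.extend_apply (Sum.elim u' w') _ (Sum.inl i)
  · exact Function.extend_apply' _ _ _ (by rintro ⟨j | j, hj⟩ <;> simp [embPQ, DFunLike.coe] at hj)
  · exact embPQ.injective.extend_apply (Sum.elim u' w') _ (Sum.inr i)
  · exact Function.extend_apply' _ _ _ (by rintro ⟨j | j, hj⟩ <;> simp [embPQ, DFunLike.coe] at hj)

lemma extend_embQR (u : Bits (Fin p)) (v v' : Bits (Fin r)) (w w' : Bits (Fin q))
    (t : Bits (Unit ⊕ Fin s)) :
    Function.extend embQR (Sum.elim w' v') (label u v w t) = label u v' w' t := by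
  funext i
  rcases i with i | i | i | i
  · exact Function.extend_apply' _ _ _ (by rintro ⟨j | j, hj⟩ <;> simp [embQR, DFunLike.coe] at hj)
  · exact embQR.injective.extend_apply (Sum.elim w' v') _ (Sum.inr i)
  · exact embQR.injective.extend_apply (Sum.elim w' v') _ (Sum.inl i)
  · exact Function.extend_apply' _ _ _ (by rintro ⟨j | j, hj⟩ <;> simp [embQR, DFunLike.coe] at hj)

lemma applyOn_embPQ (U : Matrix (Bits (Fin p ⊕ Fin q)) (Bits (Fin p ⊕ Fin q)) ℂ)
    (ψ : State (Wires p q r s)) (u : Bits (Fin p)) (v : Bits (Fin r)) (w : Bits (Fin q))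
    (t : Bits (Unit ⊕ Fin s)) :
    applyOn embPQ U ψ (label u v w t) =
      ∑ u', ∑ w', U (Sum.elim u w) (Sum.elim u' w') * ψ (label u' v w' t) := by
  have hcomp : label u v w t ∘ embPQ = Sum.elim u w := by
    funext i
    rcases i with i | i <;> rfl
  simp only [applyOn, hcomp, sum_bits_sum, extend_embPQ]

lemma applyOn_embQR (U : Matrix (Bits (Fin q ⊕ Fin r)) (Bits (Fin q ⊕ Fin r)) ℂ)
    (ψ : State (Wires p q r s)) (u : Bits (Fin p)) (v : Bits (Fin r)) (w : Bits (Fin q))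
    (t : Bits (Unit ⊕ Fin s)) :
    applyOn embQR U ψ (label u v w t) =
      ∑ w', ∑ v', U (Sum.elim w v) (Sum.elim w' v') * ψ (label u v' w' t) := by
  have hcomp : label u v w t ∘ embQR = Sum.elim w v := by
    funext i
    rcases i with i | i <;> rfl
  simp only [applyOn, hcomp, sum_bits_sum, extend_embQR]

variable {l n : ℕ}

/-- The state `|M⟩` in the registers of `p` and `r` qubits, with the register of `q` qubits in
`|0⟩` and the other qubits in `|t₀⟩`. -/
def productState (t₀ : Bits (Unit ⊕ Fin s)) (M : Matrix (Fin l) (Fin n) ℝ) :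
    State (Wires p q r s) :=
  fun x =>
    if (fun i => x (.inr (.inr (.inl i)))) = zeros (Fin q) ∧
        (fun i => x (.inr (.inr (.inr i)))) = t₀
    then ketMat p r M (fun i => x (.inl i)) (fun i => x (.inr (.inl i))) / (‖M‖ : ℂ)
    else 0

lemma productState_label (t₀ : Bits (Unit ⊕ Fin s)) (M : Matrix (Fin l) (Fin n) ℝ)
    (u : Bits (Fin p)) (v : Bits (Fin r)) (w : Bits (Fin q)) (t : Bits (Unit ⊕ Fin s)) :
    productState t₀ M (label u v w t) =
      if w = zeros _ ∧ t = t₀ then ketMat p r M u v / (‖M‖ : ℂ) else 0 := rfl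

lemma stateNorm_productState (hl : l ≤ 2 ^ p) (hn : n ≤ 2 ^ r) (t₀ : Bits (Unit ⊕ Fin s))
    {M : Matrix (Fin l) (Fin n) ℝ} (hM : M ≠ 0) :
    stateNorm (productState t₀ M : State (Wires p q r s)) = 1 := by
  have hlabel : ∀ u v, ∑ w, ∑ t, ‖(productState t₀ M : State (Wires p q r s)) (label u v w t)‖ ^ 2
      = ‖ketMat p r M u v‖ ^ 2 / ‖M‖ ^ 2 := fun u v => by
    simp [productState_label, ite_and, apply_ite norm, div_pow]
  have hnonneg : 0 ≤ stateNorm (productState t₀ M : State (Wires p q r s)) := norm_nonneg _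
  rw [← sq_eq_sq₀ hnonneg zero_le_one, one_pow, stateNorm_sq, sum_bits_sum]
  simp only [sum_bits_sum (α := Fin r), sum_bits_sum (α := Fin q)]
  change ∑ u, ∑ v, ∑ w, ∑ t, ‖(productState t₀ M : State (Wires p q r s)) (label u v w t)‖ ^ 2 = 1
  simp only [hlabel, ← Finset.sum_div]
  rw [sum_norm_ketMat_sq hl hn, div_self (pow_ne_zero _ (norm_ne_zero_iff.2 hM))]

lemma targetState_eq_productState (M : Matrix (Fin l) (Fin n) ℝ) :
    targetState p q r s M = productState (Sum.elim (fun _ => true) (zeros _)) M := by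
  funext x
  refine if_congr (and_congr funext_iff.symm ?_) rfl rfl
  simp [funext_iff, zeros, flag, Unique.forall_iff]

lemma targetState_of_flag (M : Matrix (Fin l) (Fin n) ℝ) {x : Bits (Wires p q r s)}
    (hx : x flag = true) :
    targetState p q r s M x = productState (zeros _) M (Function.update x flag false) := by
  refine if_congr (and_congr ?_ ?_) rfl rfl
  · simp [funext_iff, zeros, flag]
  · rw [flag] at hx ⊢
    simp [funext_iff, zeros, hx]

lemma stateNorm_targetState (hl : l ≤ 2 ^ p) (hn : n ≤ 2 ^ r) {M : Matrix (Fin l) (Fin n) ℝ}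
    (hM : M ≠ 0) : stateNorm (targetState p q r s M) = 1 := by
  rw [targetState_eq_productState, stateNorm_productState hl hn _ hM]

end Labels

/-! ### Preparation of a state with a component along the product -/

section Prep

variable {p q r s l m n : ℕ}

/-- The circuit that prepares a state whose component with `|0⟩` in the register of `q` qubits is
proportional to `|AB⟩`: the norms of the rows of `A`, next to `|B⟩`, and the inverse of the
preparation of the rows of `A`. -/
def prep (p q r s : ℕ) : List (Gate p q r (Wires p q r s)) :=
  [.matPrep embQR] ++ ([.normPrep embPQ] ++ [.rowPrepInv embPQ])

/-- The inverse of `prep`. -/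
def prepInv (p q r s : ℕ) : List (Gate p q r (Wires p q r s)) :=
  ([.rowPrep embPQ] ++ [.normPrepInv embPQ]) ++ [.matPrepInv embQR]

lemma applyOn_matPrep_label {O : Access p q r} {B : Matrix (Fin m) (Fin n) ℝ}
    (hB : PreparesMatrix q r B O.matPrep) (u : Bits (Fin p)) (v : Bits (Fin r)) (w : Bits (Fin q))
    (t : Bits (Unit ⊕ Fin s)) :
    applyOn embQR (O.matPrep : Matrix _ _ ℂ) (ketZero (Wires p q r s)) (label u v w t) =
      if u = zeros _ ∧ t = zeros _ then ketMat q r B w v / (‖B‖ : ℂ) else 0 := by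
  rw [applyOn_embQR, Fintype.sum_eq_single (zeros _), Fintype.sum_eq_single (zeros _), hB,
    ketZero_label]
  · simp
  · intro v' hv'
    simp [ketZero_label, hv']
  · intro w' hw'
    simp [ketZero_label, hw']

lemma applyOn_normPrep_label {O : Access p q r} {A : Matrix (Fin l) (Fin m) ℝ}
    (hA : PreparesNorms p q A O.normPrep) {ψ : State (Wires p q r s)}
    (hψ : ∀ u v w t, u ≠ zeros _ → ψ (label u v w t) = 0) (u : Bits (Fin p)) (v : Bits (Fin r))
    (w : Bits (Fin q)) (t : Bits (Unit ⊕ Fin s)) :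
    applyOn embPQ (O.normPrep : Matrix _ _ ℂ) ψ (label u v w t) =
      ketVec p (rowNorm A) u / (‖A‖ : ℂ) * ψ (label (zeros _) v w t) := by
  rw [applyOn_embPQ, Fintype.sum_eq_single (zeros _)]
  · simp [hA _ _ _]
  · intro u' hu'
    simp [hψ _ _ _ _ hu']

lemma run_prep_label {O : Access p q r} {A : Matrix (Fin l) (Fin m) ℝ}
    {B : Matrix (Fin m) (Fin n) ℝ} (hO : O.Encodes A B) (hm : m ≤ 2 ^ q)
    (u : Bits (Fin p)) (v : Bits (Fin r)) (t : Bits (Unit ⊕ Fin s)) :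
    run O (prep p q r s) (ketZero _) (label u v (zeros _) t) =
      if t = zeros _ then ketMat p r (A * B) u v / ((‖A‖ : ℂ) * ‖B‖) else 0 := by
  obtain ⟨φ, hφ, hφA⟩ := hO.rows u
  have hmat := applyOn_matPrep_label (s := s) hO.matrix
  have hnorm := applyOn_normPrep_label hO.norms
    (ψ := applyOn embQR (O.matPrep : Matrix _ _ ℂ) (ketZero (Wires p q r s)))
    fun u v w t hu => by rw [hmat, if_neg fun h => hu h.1]
  simp only [prep, run_append, run_cons, run_nil, Gate.act]
  rw [applyOn_embPQ]
  simp only [Matrix.star_apply, hφ, hnorm, hmat, true_and]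
  rw [Fintype.sum_eq_single u (by intro u' hu'; simp [hu'])]
  simp only [if_true]
  split_ifs with ht
  · rw [← sum_ketMat_mul_ketMat hm, Finset.sum_div]
    refine Finset.sum_congr rfl fun w _ => ?_
    rw [← ketVec_rowNorm_mul_star hφA, div_mul_div_comm, mul_div_assoc']
    ring
  · simp

end Prep

/-! ### The workspace of a round -/

section Wires

variable {p q r l m n : ℕ}

/-- The registers of row indices of `A`, column indices of `B`, and of column indices of `A`. -/
abbrev Register (p q r : ℕ) : Type := Fin p ⊕ Fin r ⊕ Fin q

/-- The number of ancilla qubits of a round, one for each register qubit. -/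
abbrev ancillaCount (p q r : ℕ) : ℕ := Fintype.card (Register p q r)

/-- The qubits of a round as a workspace. -/
def wires (p q r : ℕ) : Workspace (Register p q r) (Wires p q r (ancillaCount p q r)) where
  register := Sum.map id (Sum.map id Sum.inl)
  ancilla i := .inr (.inr (.inr (.inr (Fintype.equivFin _ i))))
  flag := flag
  ancilla_injective i j h := by simpa using h
  register_ne_ancilla := by rintro (i | i | i) j <;> simp
  register_ne_flag := by rintro (i | i | i) <;> simp [flag]
  flag_ne_ancilla i := by simp [flag]
  cover := by
    rintro (i | i | i | i | i)
    · exact .inl ⟨.inl i, rfl⟩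
    · exact .inl ⟨.inr (.inl i), rfl⟩
    · exact .inl ⟨.inr (.inr i), rfl⟩
    · exact .inr (.inl rfl)
    · exact .inr (.inr ⟨(Fintype.equivFin _).symm i, by simp⟩)

/-- The register of column indices of `A`. -/
def middle (p q r : ℕ) : Finset (Register p q r) := Finset.univ.image fun i => .inr (.inr i)

lemma inversePair_prep (O : Access p q r) :
    InversePair O (wires p q r).idle (prep p q r _) (prepInv p q r _) := by
  have hPQ : ∀ i, embPQ i ∉ (wires p q r).idle := by
    rintro (i | i)
    exacts [(wires p q r).register_notMem_idle (.inl i),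
      (wires p q r).register_notMem_idle (.inr (.inr i))]
  have hQR : ∀ i, embQR i ∉ (wires p q r).idle := by
    rintro (i | i)
    exacts [(wires p q r).register_notMem_idle (.inr (.inr i)),
      (wires p q r).register_notMem_idle (.inr (.inl i))]
  exact (inversePair_of_unitary embQR hQR O.matPrep.2 rfl rfl).append
    ((inversePair_of_unitary embPQ hPQ O.normPrep.2 rfl rfl).append
      (inversePair_of_unitary embPQ hPQ (Unitary.star_mem O.rowPrep.2) rfl
        (by rw [star_star]; rfl)))

lemma zeroProj_middle_mulVec_run_prep {O : Access p q r} {A : Matrix (Fin l) (Fin m) ℝ}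
    {B : Matrix (Fin m) (Fin n) ℝ} (hO : O.Encodes A B) (hm : m ≤ 2 ^ q) (hAB : A * B ≠ 0) :
    (wires p q r).zeroProj (middle p q r) *ᵥ run O (prep p q r _) (ketZero _) =
      ((‖A * B‖ / (‖A‖ * ‖B‖) : ℝ) : ℂ) • productState (zeros _) (A * B) := by
  funext x
  obtain ⟨u, v, w, t, rfl⟩ := exists_eq_label x
  have hmiddle : (∀ i ∈ middle p q r, label u v w t ((wires p q r).register i) = false) ↔
      w = zeros _ := by
    simp [middle, wires, label, funext_iff, zeros]
  have hnorm : ((‖A * B‖ : ℝ) : ℂ) ≠ 0 := Complex.ofReal_ne_zero.2 (norm_ne_zero_iff.2 hAB)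
  simp only [Workspace.zeroProj_mulVec, hmiddle, Pi.smul_apply, smul_eq_mul, productState_label,
    ite_and]
  split_ifs with hw ht
  · subst hw ht
    rw [run_prep_label hO hm, if_pos rfl]
    push_cast
    field_simp
  · rw [hw, run_prep_label hO hm, if_neg ht, mul_zero]
  · rw [mul_zero]

end Wires

/-! ### Rounds -/

section Rounds

variable {p q r l m n : ℕ}

/-- A round with `j` steps of amplitude amplification, which succeeds when the register of column
indices of `A` is found in `|0⟩`. -/
def amplifiedRound (p q r j : ℕ) : Round p q r where
  ancillas := ancillaCount p q r
  circuit := (wires p q r).amplify (prep p q r _) (prepInv p q r _) (middle p q r) j ++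
    (wires p q r).flagCircuit (middle p q r)

variable {O : Access p q r} {A : Matrix (Fin l) (Fin m) ℝ} {B : Matrix (Fin m) (Fin n) ℝ} {θ : ℝ}

lemma successPart_amplifiedRound (hO : O.Encodes A B) (hl : l ≤ 2 ^ p) (hm : m ≤ 2 ^ q)
    (hn : n ≤ 2 ^ r) (hAB : A * B ≠ 0) (hθ : Real.sin θ = ‖A * B‖ / (‖A‖ * ‖B‖)) (j : ℕ) :
    (amplifiedRound p q r j).successPart O =
      (((-1) ^ j * Real.sin ((2 * j + 1) * θ) : ℝ) : ℂ) • targetState p q r _ (A * B) := by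
  have hunit : star (productState (zeros _) (A * B) : State (Wires p q r (ancillaCount p q r))) ⬝ᵥ
      productState (zeros _) (A * B) = 1 := by
    rw [star_dotProduct_self, stateNorm_productState hl hn _ hAB, one_pow, Complex.ofReal_one]
  have hprep := zeroProj_middle_mulVec_run_prep hO hm hAB
  rw [← hθ] at hprep
  funext x
  simp only [Round.successPart, Pi.smul_apply, smul_eq_mul]
  split_ifs with hx
  · rw [targetState_of_flag _ hx]
    exact Workspace.run_amplify_append_flagCircuit (inversePair_prep O) hunit hprep j hx
  · rw [targetState, if_neg fun h => hx h.2.1, mul_zero]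

lemma stateNorm_successPart_amplifiedRound (hO : O.Encodes A B) (hl : l ≤ 2 ^ p) (hm : m ≤ 2 ^ q)
    (hn : n ≤ 2 ^ r) (hAB : A * B ≠ 0) (hθ : Real.sin θ = ‖A * B‖ / (‖A‖ * ‖B‖)) (j : ℕ) :
    stateNorm ((amplifiedRound p q r j).successPart O) = |Real.sin ((2 * j + 1) * θ)| := by
  rw [successPart_amplifiedRound hO hl hm hn hAB hθ, stateNorm_smul,
    stateNorm_targetState hl hn hAB, Complex.norm_real, Real.norm_eq_abs, abs_mul, abs_pow, abs_neg,
    abs_one, one_pow, one_mul, mul_one]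

lemma successProb_amplifiedRound (hO : O.Encodes A B) (hl : l ≤ 2 ^ p) (hm : m ≤ 2 ^ q)
    (hn : n ≤ 2 ^ r) (hAB : A * B ≠ 0) (hθ : Real.sin θ = ‖A * B‖ / (‖A‖ * ‖B‖)) (j : ℕ) :
    (amplifiedRound p q r j).successProb O = Real.sin ((2 * j + 1) * θ) ^ 2 := by
  rw [Round.successProb, stateNorm_successPart_amplifiedRound hO hl hm hn hAB hθ, sq_abs]

lemma isClose_outputState_amplifiedRound (hO : O.Encodes A B) (hl : l ≤ 2 ^ p) (hm : m ≤ 2 ^ q)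
    (hn : n ≤ 2 ^ r) (hAB : A * B ≠ 0) (hθ : Real.sin θ = ‖A * B‖ / (‖A‖ * ‖B‖)) {j : ℕ}
    (hj : (amplifiedRound p q r j).successProb O ≠ 0) :
    IsClose 0 ((amplifiedRound p q r j).outputState O) (targetState p q r _ (A * B)) := by
  rw [successProb_amplifiedRound hO hl hm hn hAB hθ, pow_ne_zero_iff two_ne_zero] at hj
  rw [Round.outputState, stateNorm_successPart_amplifiedRound hO hl hm hn hAB hθ,
    successPart_amplifiedRound hO hl hm hn hAB hθ, smul_smul]
  refine isClose_smul ?_ _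
  rw [norm_mul, norm_inv, Complex.norm_real, Complex.norm_real, Real.norm_eq_abs, Real.norm_eq_abs,
    abs_abs, abs_mul, abs_pow, abs_neg, abs_one, one_pow, one_mul,
    inv_mul_cancel₀ (abs_ne_zero.2 hj)]

lemma time_amplifiedRound_le (τ : ℝ) (j : ℕ) :
    (amplifiedRound p q r j).time τ ≤ (2 * j + 1) * (3 * τ + 6 * (p + q + r) + 7) := by
  have hprep : gateTime τ (prep p q r (ancillaCount p q r)) ≤ 3 * τ := by
    simp only [prep, gateTime_append, gateTime_cons, gateTime_nil, Gate.time]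
    linarith
  have hprepInv : gateTime τ (prepInv p q r (ancillaCount p q r)) ≤ 3 * τ := by
    simp only [prepInv, gateTime_append, gateTime_cons, gateTime_nil, Gate.time]
    linarith
  have hgates := (wires p q r).gateTime_amplify_append_flagCircuit_le (middle p q r) hprep
    hprepInv j
  simp only [Fintype.card_sum, Fintype.card_fin, Nat.cast_add] at hgates
  calc (amplifiedRound p q r j).time τ ≤ (2 * j + 1) * (3 * τ + 6 * (p + (r + q)) + 6) + 1 := by
        rw [Round.time]
        gcongr
        exact hgates
    _ ≤ (2 * j + 1) * (3 * τ + 6 * (p + q + r) + 7) := by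
        have := j.cast_nonneg (α := ℝ)
        linarith

end Rounds

/-! ### Real estimates -/

section RealEstimates

variable {l m n : ℕ} {A : Matrix (Fin l) (Fin m) ℝ} {B : Matrix (Fin m) (Fin n) ℝ}

lemma dims_ne_zero_of_mul_ne_zero (hAB : A * B ≠ 0) : l ≠ 0 ∧ m ≠ 0 ∧ n ≠ 0 := by
  refine ⟨?_, ?_, ?_⟩ <;> rintro rfl <;> refine hAB ?_
  · exact Subsingleton.elim _ _
  · rw [Subsingleton.elim A 0, Matrix.zero_mul]
  · exact Subsingleton.elim _ _

lemma norm_mul_div_mem_Ioc (hAB : A * B ≠ 0) : ‖A * B‖ / (‖A‖ * ‖B‖) ∈ Set.Ioc 0 1 := by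
  have hnorm := norm_pos_iff.2 hAB
  have hle := Matrix.frobenius_norm_mul A B
  exact ⟨div_pos hnorm (hnorm.trans_le hle), div_le_one_of_le₀ hle (by positivity)⟩

lemma exists_three_pow_mul_le_sin_sq_ge {s : ℝ} (hs : 0 < s) (hs1 : s ≤ 1) :
    ∃ E : ℕ, 3 ^ E * s ≤ 2 ∧ 1 / 4 ≤ Real.sin (3 ^ E * Real.arcsin s) ^ 2 := by
  have hpos : 0 < Real.arcsin s := Real.arcsin_pos.2 hs
  have hs_le : s ≤ Real.arcsin s := by
    simpa [Real.sin_arcsin (by linarith) hs1] using Real.sin_le hpos.le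
  obtain ⟨E, hle, hlt⟩ := exists_nat_pow_near
    ((one_le_div hpos).2 (Real.arcsin_le_pi_div_two s)) (by norm_num : (1 : ℝ) < 3)
  rw [le_div_iff₀ hpos] at hle
  rw [div_lt_iff₀ hpos, pow_succ] at hlt
  refine ⟨E, ?_, ?_⟩
  · calc 3 ^ E * s ≤ 3 ^ E * Real.arcsin s := by gcongr
      _ ≤ 2 := by linarith [Real.pi_le_four]
  · have hsin : 1 / 2 ≤ Real.sin (3 ^ E * Real.arcsin s) := by
      rw [← Real.sin_pi_div_six]
      exact Real.sin_le_sin_of_le_of_le_pi_div_two (by linarith [Real.pi_pos]) hle (by linarith)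
    calc (1 / 4 : ℝ) = (1 / 2) ^ 2 := by norm_num
      _ ≤ Real.sin (3 ^ E * Real.arcsin s) ^ 2 := by gcongr

/-- The number of repetitions of each round. It makes the probability that all of them fail at most
`δ` when a single one fails with probability at most `3 / 4`. -/
def repetitions (δ : ℝ) : ℕ := ⌈4 * Real.log (1 / δ)⌉₊ + 1

lemma repetitions_pos (δ : ℝ) : 0 < repetitions δ := Nat.succ_pos _

lemma repetitions_le {δ : ℝ} (hδ : 0 < δ) (hδ1 : δ ≤ 1) :
    (repetitions δ : ℝ) ≤ 4 * (1 + Real.log (1 / δ)) := by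
  have hlog : 0 ≤ Real.log (1 / δ) := Real.log_nonneg ((one_le_div hδ).2 hδ1)
  have hceil := Nat.ceil_lt_add_one (mul_nonneg zero_le_four hlog)
  rw [repetitions, Nat.cast_add, Nat.cast_one]
  linarith

lemma pow_repetitions_le {δ : ℝ} (hδ : 0 < δ) : (3 / 4 : ℝ) ^ repetitions δ ≤ δ := by
  have hexp : (3 / 4 : ℝ) ≤ Real.exp (-1 / 4) := by linarith [Real.add_one_le_exp (-1 / 4 : ℝ)]
  have hceil := Nat.le_ceil (4 * Real.log (1 / δ))
  calc (3 / 4 : ℝ) ^ repetitions δ ≤ Real.exp (-1 / 4) ^ repetitions δ := by gcongr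
    _ = Real.exp (repetitions δ * (-1 / 4)) := (Real.exp_nat_mul _ _).symm
    _ ≤ Real.exp (Real.log δ) := by
      gcongr
      rw [one_div, Real.log_inv] at hceil
      rw [repetitions, one_div, Real.log_inv, Nat.cast_add, Nat.cast_one]
      linarith
    _ = δ := Real.exp_log hδ

lemma sum_range_mul_div {S : Type*} [Semiring S] (f : ℕ → S) {R : ℕ} (hR : 0 < R) (E : ℕ) :
    ∑ j ∈ Finset.range (E * R), f (j / R) = R * ∑ e ∈ Finset.range E, f e := by
  induction E with
  | zero => simp
  | succ E ih =>
    have hblock : ∑ j ∈ Finset.range R, f ((E * R + j) / R) = ∑ _j ∈ Finset.range R, f E :=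
      Finset.sum_congr rfl fun j hj => by
        rw [mul_comm, Nat.mul_add_div hR, Nat.div_eq_of_lt (Finset.mem_range.1 hj), add_zero]
    rw [Nat.succ_mul, Finset.sum_range_add, ih, hblock, Finset.sum_range_succ, mul_add,
      Finset.sum_const, Finset.card_range, nsmul_eq_mul]

lemma prod_range_one_sub_le {f : ℕ → ℝ} (h0 : ∀ e, 0 ≤ f e) (h1 : ∀ e, f e ≤ 1) {R E : ℕ}
    (hR : 0 < R) {c : ℝ} (hc : c ≤ f E) :
    ∏ j ∈ Finset.range ((E + 1) * R), (1 - f (j / R)) ≤ (1 - c) ^ R := by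
  have hfirst : ∏ j ∈ Finset.range (E * R), (1 - f (j / R)) ≤ 1 :=
    Finset.prod_le_one (fun j _ => sub_nonneg.2 (h1 _)) fun j _ => sub_le_self _ (h0 _)
  have hlast : ∏ j ∈ Finset.range R, (1 - f ((E * R + j) / R)) = ∏ _j ∈ Finset.range R, (1 - f E) :=
    Finset.prod_congr rfl fun j hj => by
      rw [mul_comm, Nat.mul_add_div hR, Nat.div_eq_of_lt (Finset.mem_range.1 hj), add_zero]
  have hE : 0 ≤ 1 - f E := sub_nonneg.2 (h1 E)
  rw [Nat.succ_mul, Finset.prod_range_add, hlast, Finset.prod_const, Finset.card_range]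
  calc (∏ j ∈ Finset.range (E * R), (1 - f (j / R))) * (1 - f E) ^ R
      ≤ 1 * (1 - f E) ^ R := by gcongr
    _ ≤ (1 - c) ^ R := by
      rw [one_mul]
      gcongr

lemma clog_two_le (n : ℕ) : (Nat.clog 2 n : ℝ) ≤ 1 + 2 * Real.log n := by
  rcases Nat.lt_or_ge 1 n with hn | hn
  · have hclog : 0 < Nat.clog 2 n := Nat.clog_pos one_lt_two hn
    have hpow : ((Nat.clog 2 n - 1 : ℕ) : ℝ) * Real.log 2 ≤ Real.log n := by
      rw [← Real.log_pow]
      refine Real.log_le_log (by positivity) ?_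
      exact_mod_cast (Nat.pow_pred_clog_lt_self one_lt_two hn).le
    rw [Nat.cast_sub hclog, Nat.cast_one] at hpow
    have hclog_one : (1 : ℝ) ≤ Nat.clog 2 n := by exact_mod_cast hclog
    nlinarith [Real.log_two_gt_d9]
  · interval_cases n <;> simp

lemma one_le_one_add_log (l m n : ℕ) : 1 ≤ 1 + Real.log (l * m * n) := by
  have hlog := Real.log_natCast_nonneg (l * m * n)
  push_cast at hlog
  linarith

lemma one_le_condNumber (hA : A ≠ 0) : 1 ≤ condNumber A := by
  set T := Matrix.toEuclideanLin A with hT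
  have hrank : A.rank = Module.finrank ℝ T.range :=
    A.rank_eq_finrank_range_toLin (EuclideanSpace.basisFun _ ℝ).toBasis
      (EuclideanSpace.basisFun _ ℝ).toBasis
  have hT0 : T ≠ 0 := by simpa [hT] using hA
  have hfinrank : Module.finrank ℝ T.range ≠ 0 := fun h =>
    hT0 (LinearMap.range_eq_bot.1 (Submodule.finrank_eq_zero.1 h))
  have hpos : 0 < T.singularValues (A.rank - 1) :=
    T.singularValues_pos_iff_lt_finrank_range.2 (by omega)
  rw [condNumber, le_div_iff₀ hpos, one_mul]
  exact T.singularValues_antitone (Nat.zero_le _)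

lemma norm_ratio_le_condNumber (hAB : A * B ≠ 0) {ε : ℝ} (hε : 0 < ε) (hε1 : ε ≤ 1) :
    ‖A‖ * ‖B‖ / ‖A * B‖ ≤ ‖A‖ * ‖B‖ * condNumber A ^ 2 / (ε * ‖A * B‖) := by
  have hA : A ≠ 0 := by rintro rfl; simp at hAB
  have hκ : 1 ≤ condNumber A ^ 2 := one_le_pow₀ (one_le_condNumber hA)
  have hnorm : 0 < ‖A * B‖ := norm_pos_iff.2 hAB
  exact div_le_div₀ (by positivity) (le_mul_of_one_le_right (by positivity) hκ) (by positivity)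
    (mul_le_of_le_one_left hnorm.le hε1)

lemma time_bound_le (hAB : A * B ≠ 0) {C ε L Λ : ℝ} (hC : 0 ≤ C) (hε : 0 < ε)
    (hε1 : ε ≤ 1) (hL : 0 ≤ L) (hΛ : 1 ≤ Λ) (a : ℕ) :
    C * (‖A‖ * ‖B‖ / ‖A * B‖) * (Λ ^ a + Λ) * L ≤
      2 * C * (‖A‖ * ‖B‖ * condNumber A ^ 2 / (ε * ‖A * B‖)) * Λ ^ (a + 1) * L := by
  have hpow : Λ ^ a + Λ ≤ 2 * Λ ^ (a + 1) := by
    have hself : Λ ≤ Λ ^ (a + 1) := le_self_pow₀ hΛ a.succ_ne_zero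
    linarith [pow_le_pow_right₀ hΛ (Nat.le_add_right a 1)]
  calc C * (‖A‖ * ‖B‖ / ‖A * B‖) * (Λ ^ a + Λ) * L
      ≤ C * (‖A‖ * ‖B‖ * condNumber A ^ 2 / (ε * ‖A * B‖)) * (2 * Λ ^ (a + 1)) * L := by
        gcongr C * ?_ * ?_ * L
        exact norm_ratio_le_condNumber hAB hε hε1
    _ = 2 * C * (‖A‖ * ‖B‖ * condNumber A ^ 2 / (ε * ‖A * B‖)) * Λ ^ (a + 1) * L := by ring

end RealEstimates

/-! ### The algorithm -/

section Algorithm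

/-- The number of steps of amplitude amplification in the round of index `e`, chosen so that they
multiply the angle `θ` by `3 ^ e`. -/
def iterations (e : ℕ) : ℕ := ∑ i ∈ Finset.range e, 3 ^ i

lemma two_mul_iterations_add_one (e : ℕ) : 2 * (iterations e : ℝ) + 1 = 3 ^ e := by
  have hgeom := geom_sum_mul (3 : ℝ) e
  rw [iterations, Nat.cast_sum]
  push_cast
  linarith

/-- Rounds of exponentially increasing length, each repeated the same number of times: no knowledge
of the success amplitude is needed. -/
def productAlgorithm (l m n : ℕ) (δ : ℝ) : Algorithm l m n :=
  fun j => amplifiedRound _ _ _ (iterations (j / repetitions δ))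

variable {l m n : ℕ}

lemma time_productAlgorithm_le {δ τ : ℝ} (hδ : 0 < δ) (hδ1 : δ ≤ 1) (hτ : 0 ≤ τ) (hl : l ≠ 0)
    (hm : m ≠ 0) (hn : n ≠ 0) (E : ℕ) :
    (productAlgorithm l m n δ).time τ ((E + 1) * repetitions δ) ≤
      150 * 3 ^ E * (τ + (1 + Real.log (l * m * n))) * (1 + Real.log (1 / δ)) := by
  set Λ := 1 + Real.log (l * m * n) with hΛ
  have hΛ1 : 1 ≤ Λ := one_le_one_add_log l m n
  have hlogδ : 0 ≤ Real.log (1 / δ) := Real.log_nonneg ((one_le_div hδ).2 hδ1)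
  have hround : 3 * τ + 6 * (Nat.clog 2 l + Nat.clog 2 m + Nat.clog 2 n) + 7 ≤ 25 * (τ + Λ) := by
    have hlog : Real.log (l * m * n) = Real.log l + Real.log m + Real.log n := by
      rw [Real.log_mul (by positivity) (by positivity), Real.log_mul (by positivity)
        (by positivity)]
    linarith [clog_two_le l, clog_two_le m, clog_two_le n]
  calc (productAlgorithm l m n δ).time τ ((E + 1) * repetitions δ)
      ≤ ∑ j ∈ Finset.range ((E + 1) * repetitions δ),
          (3 : ℝ) ^ (j / repetitions δ) * (25 * (τ + Λ)) := by
        refine Finset.sum_le_sum fun j _ => (time_amplifiedRound_le τ _).trans ?_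
        rw [two_mul_iterations_add_one]
        gcongr
    _ = repetitions δ * (∑ e ∈ Finset.range (E + 1), (3 : ℝ) ^ e) * (25 * (τ + Λ)) := by
        rw [← Finset.sum_mul, sum_range_mul_div (fun e => (3 : ℝ) ^ e) (repetitions_pos δ)]
    _ ≤ (4 * (1 + Real.log (1 / δ))) * (3 ^ (E + 1) / 2) * (25 * (τ + Λ)) := by
        gcongr
        · exact repetitions_le hδ hδ1
        · linarith [geom_sum_mul (3 : ℝ) (E + 1)]
    _ = 150 * 3 ^ E * (τ + Λ) * (1 + Real.log (1 / δ)) := by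
        rw [pow_succ (3 : ℝ)]
        ring

variable {O : Access (Nat.clog 2 l) (Nat.clog 2 m) (Nat.clog 2 n)}
  {A : Matrix (Fin l) (Fin m) ℝ} {B : Matrix (Fin m) (Fin n) ℝ} {θ δ : ℝ}

lemma successProb_productAlgorithm_round (hO : O.Encodes A B) (hAB : A * B ≠ 0)
    (hθ : Real.sin θ = ‖A * B‖ / (‖A‖ * ‖B‖)) (δ : ℝ) (j : ℕ) :
    (productAlgorithm l m n δ j).successProb O = Real.sin (3 ^ (j / repetitions δ) * θ) ^ 2 := by
  rw [productAlgorithm, successProb_amplifiedRound hO (Nat.le_pow_clog one_lt_two l)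
    (Nat.le_pow_clog one_lt_two m) (Nat.le_pow_clog one_lt_two n) hAB hθ,
    two_mul_iterations_add_one]

lemma one_sub_le_successProb_productAlgorithm (hO : O.Encodes A B) (hAB : A * B ≠ 0)
    (hθ : Real.sin θ = ‖A * B‖ / (‖A‖ * ‖B‖)) (hδ : 0 < δ) {E : ℕ}
    (hE : 1 / 4 ≤ Real.sin (3 ^ E * θ) ^ 2) :
    1 - δ ≤ (productAlgorithm l m n δ).successProb O ((E + 1) * repetitions δ) := by
  have hfail := prod_range_one_sub_le (f := fun e => Real.sin (3 ^ e * θ) ^ 2)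
    (fun _ => sq_nonneg _) (fun _ => Real.sin_sq_le_one _) (repetitions_pos δ) hE
  simp only [Algorithm.successProb, successProb_productAlgorithm_round hO hAB hθ]
  have hpow : (1 - 1 / 4 : ℝ) ^ repetitions δ ≤ δ := by
    convert pow_repetitions_le hδ using 2
    norm_num
  linarith

end Algorithm

end QMatMul
end

open QMatMul

theorem mainTheorem9_general :
    ∃ (alg : (l m n : ℕ) → (δ : ℝ) → Algorithm l m n) (C : ℝ), 0 < C ∧
      ∀ (l m n : ℕ) (A : Matrix (Fin l) (Fin m) ℝ) (B : Matrix (Fin m) (Fin n) ℝ), A * B ≠ 0 →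
        ∀ δ : ℝ, 0 < δ → δ < 1 →
        ∀ O : Access (Nat.clog 2 l) (Nat.clog 2 m) (Nat.clog 2 n), O.Encodes A B →
          (∀ j : ℕ, (alg l m n δ j).successProb O ≠ 0 →
            IsClose 0 ((alg l m n δ j).outputState O)
              (targetState _ _ _ _ (A * B))) ∧
          ∃ K : ℕ,
            1 - δ ≤ (alg l m n δ).successProb O K ∧
            ∀ τ : ℝ, 0 ≤ τ → (alg l m n δ).time τ K ≤
              C * (‖A‖ * ‖B‖ / ‖A * B‖) * (τ + (1 + Real.log (l * m * n))) *
                (1 + Real.log (1 / δ)) := by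
  refine ⟨productAlgorithm, 300, by norm_num, fun l m n A B hAB δ hδ hδ1 O hO => ?_⟩
  obtain ⟨hl, hm, hn⟩ := dims_ne_zero_of_mul_ne_zero hAB
  obtain ⟨hs0, hs1⟩ := norm_mul_div_mem_Ioc hAB
  set s := ‖A * B‖ / (‖A‖ * ‖B‖) with hs
  have hθ : Real.sin (Real.arcsin s) = s := Real.sin_arcsin (by linarith) hs1
  obtain ⟨E, hE, hsin⟩ := exists_three_pow_mul_le_sin_sq_ge hs0 hs1
  refine ⟨fun j => isClose_outputState_amplifiedRound hO (Nat.le_pow_clog one_lt_two l)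
    (Nat.le_pow_clog one_lt_two m) (Nat.le_pow_clog one_lt_two n) hAB hθ, (E + 1) * repetitions δ,
    one_sub_le_successProb_productAlgorithm hO hAB hθ hδ hsin, fun τ hτ => ?_⟩
  have hpow : (3 : ℝ) ^ E ≤ 2 * (‖A‖ * ‖B‖ / ‖A * B‖) := by
    rwa [← inv_div, ← hs, ← div_eq_mul_inv, le_div_iff₀ hs0]
  have hΛ := one_le_one_add_log l m n
  have hlogδ : 0 ≤ Real.log (1 / δ) := Real.log_nonneg ((one_le_div hδ).2 hδ1.le)
  calc (productAlgorithm l m n δ).time τ ((E + 1) * repetitions δ)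
      ≤ 150 * 3 ^ E * (τ + (1 + Real.log (l * m * n))) * (1 + Real.log (1 / δ)) :=
        time_productAlgorithm_le hδ hδ1.le hτ hl hm hn E
    _ ≤ 150 * (2 * (‖A‖ * ‖B‖ / ‖A * B‖)) * (τ + (1 + Real.log (l * m * n))) *
        (1 + Real.log (1 / δ)) := by gcongr
    _ = _ := by ring

theorem mainTheorem9 :
    ∃ alg : (l m n : ℕ) → (ε δ : ℝ) → QMatMul.Algorithm l m n,
      ∀ a : ℕ, ∃ (C : ℝ) (k : ℕ), ∀ (l m n : ℕ)
        (A : Matrix (Fin l) (Fin m) ℝ) (B : Matrix (Fin m) (Fin n) ℝ), A * B ≠ 0 →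
        ∀ ε δ : ℝ, 0 < ε → ε ≤ 1 → 0 < δ → δ < 1 →
        ∀ O : QMatMul.Access (Nat.clog 2 l) (Nat.clog 2 m) (Nat.clog 2 n), O.Encodes A B →
          (∀ j : ℕ, (alg l m n ε δ j).successProb O ≠ 0 →
            QMatMul.IsClose ε ((alg l m n ε δ j).outputState O)
              (QMatMul.targetState _ _ _ _ (A * B))) ∧
          ∃ K : ℕ,
            1 - δ ≤ (alg l m n ε δ).successProb O K ∧
            (alg l m n ε δ).time ((1 + Real.log (l * m * n)) ^ a) K ≤
              C * (‖A‖ * ‖B‖ * QMatMul.condNumber A ^ 2 / (ε * ‖A * B‖)) *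
                (1 + Real.log (l * m * n)) ^ k * (1 + Real.log (1 / δ)) := by
  obtain ⟨alg, C, hC, halg⟩ := mainTheorem9_general
  refine ⟨fun l m n _ => alg l m n, fun a => ⟨2 * C, a + 1, ?_⟩⟩
  intro l m n A B hAB ε δ hε hε1 hδ hδ1 O hO
  obtain ⟨hclose, K, hK, htime⟩ := halg l m n A B hAB δ hδ hδ1 O hO
  have hΛ := one_le_one_add_log l m n
  have hL : 0 ≤ 1 + Real.log (1 / δ) := by
    linarith [Real.log_nonneg ((one_le_div hδ).2 hδ1.le)]
  exact ⟨fun j hj => (hclose j hj).mono hε.le, K, hK,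
    (htime _ (by positivity)).trans (time_bound_le hAB hC.le hε hε1 hL hΛ a)⟩
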